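/- **Notation.** $\mathcal S_0(\mathbb R)$ is the space of Schwartz functions on $\mathbb R$ all of whose moments $\int x^k\varphi(x)\,dx$, $k\in\mathbb N_0$, vanish, with the topology of $\mathcal S(\mathbb R)$; $\mathcal S_0'(\mathbb R)$ is its dual (the Lizorkin distributions). By the Hahn–Banach theorem every $f\in\mathcal S_0'(\mathbb R)$ is the restriction to $\mathcal S_0(\mathbb R)$ of some tempered distribution, called a representative of $f$ (it is unique up to a polynomial). Let $\mathbb Y=\mathbb R\times(\mathbb R\setminus\{0\})$, let $\mathcal S(\mathbb Y)$ be the space of all $\Phi\in C^\infty(\mathbb Y)$ with $$\sup_{(x,\xi)\in\mathbb Y}\big(|\xi|^s+|\xi|^{-s}\big)\,|x^r\partial_\xi^l\partial_x^m\Phi(x,\xi)|<\infty\qquad (s,r,l,m\in\mathbb N_0),$$ and let $\mathcal S'(\mathbb Y)$ be its dual; a function $G$ on $\mathbb Y$ acts by $\langle G,\Phi\rangle=\iint_{\mathbb Y}G\,\Phi\,dx\,d\xi$. Put $g_a(t)=g(at)$ and $M_ah(t)=e^{iat}h(t)$. For $\alpha\notin\pi\mathbb Z$ let $c_1=\cot\alpha$,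 $c_2=\csc\alpha$, $C_\alpha=\sqrt{(1-ic_1)/(2\pi)}$ (principal square roots) and $K_\alpha(t,\xi)=C_\alpha e^{i(\frac{t^2+\xi^2}{2}c_1-t\xi c_2)}$. For $g\in\mathcal S(\mathbb R)$, $F\in\mathcal S'(\mathbb R)$, $x\in\mathbb R$, $\xi\ne0$, the fractional Stockwell transform (FRST) and the Stockwell transform are $$S_g^\alpha F(x,\xi)=|\xi|\,\big\langle F(t),\overline{g(\xi(t-x))}\,K_\alpha(t,\xi)\big\rangle,\qquad S_gF(x,\xi)=\frac{|\xi|}{\sqrt{2\pi}}\,\big\langle F(t),\overline{g(\xi(t-x))}\,e^{-i\xi t}\big\rangle .$$ A function $L$ is slowly varying at $0$ if it is measurable and positive on some interval $(0,A]$, $A>0$, and $L(a\varepsilon)/L(\varepsilon)\to1$ as $\varepsilon\to0^+$ for each $a>0$. **Theorem.** Let $f,u\in\mathcal S_0'(\mathbb R)$, $m\in\mathbb R$, and let $L$ be slowly varying at $0$. Suppose that $$f(\varepsilon x)\sim\varepsilon^mL(\varepsilon)\,u(x)\quad\text{as }\varepsilon\to0^+\text{ in }\mathcal S_0'(\mathbb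 R),$$ i.e. $\langle f(\varepsilon x),\varphi(x)\rangle/(\varepsilon^mL(\varepsilon))\to\langle u,\varphi\rangle$ for every $\varphi\in\mathcal S_0(\mathbb R)$, where $\langle f(\varepsilon x),\varphi(x)\rangle=\varepsilon^{-1}\langle f(x),\varphi(x/\varepsilon)\rangle$. Let $g\in\mathcal S_0(\mathbb R)\setminus\{0\}$ and $\alpha\in(2k\pi,(2k+1)\pi)$ for some $k\in\mathbb Z$. Then, for all tempered representatives of $f$ and of $u$ (denoted again by $f$ and $u$), $$e^{-ic_1(\varepsilon\xi)^2/2}\,S^\alpha_{g_{1/\varepsilon^2}}f(\varepsilon x,\varepsilon\xi)\sim\frac{\sqrt{1-ic_1}}{c_2^{\,m}}\,\varepsilon^{m+2}L(\varepsilon)\,S_g(M_{\xi/c_2}u)\Big(xc_2,\frac{\xi}{c_2}\Big)\quad\text{as }\varepsilon\to0^+\text{ in }\mathcal S'(\mathbb Y).$$ That is: for all sufficiently small $\varepsilon>0$ the left-hand side, and also $\frac{\sqrt{1-ic_1}}{c_2^{m}}S_g(M_{\xi/c_2}u)(xc_2,\xi/c_2)$, are, as functions of $(x,\xi)\in\mathbb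 Y$, elements of $\mathcal S'(\mathbb Y)$ (the integrals $\langle\cdot,\Phi\rangle$ converge absolutely and are continuous in $\Phi\in\mathcal S(\mathbb Y)$), and for every $\Phi\in\mathcal S(\mathbb Y)$ $$\lim_{\varepsilon\to0^+}\frac{1}{\varepsilon^{m+2}L(\varepsilon)}\iint_{\mathbb Y}e^{-ic_1(\varepsilon\xi)^2/2}S^\alpha_{g_{1/\varepsilon^2}}f(\varepsilon x,\varepsilon\xi)\,\Phi(x,\xi)\,dx\,d\xi=\frac{\sqrt{1-ic_1}}{c_2^{\,m}}\iint_{\mathbb Y}S_g(M_{\xi/c_2}u)\Big(xc_2,\frac{\xi}{c_2}\Big)\Phi(x,\xi)\,dx\,d\xi .$$ -/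

import Mathlib

open Filter Topology MeasureTheory
open scoped SchwartzMap ENNReal NNReal ContDiff

noncomputable section

namespace Stockwell

/-! ### Chirps have temperate growth -/

theorem hasTemperateGrowth_cexp_I :
    Function.HasTemperateGrowth (fun x : ℝ => Complex.exp (Complex.I * (x : ℂ))) := by
  have hsm : ContDiff ℝ ∞ (fun x : ℝ => Complex.exp (Complex.I * (x : ℂ))) :=
    (contDiff_const.mul Complex.ofRealCLM.contDiff).cexp
  have hd : ∀ n : ℕ, iteratedDeriv n (fun x : ℝ => Complex.exp (Complex.I * (x : ℂ)))
      = fun x : ℝ => Complex.I ^ n * Complex.exp (Complex.I * (x : ℂ)) := by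
    intro n
    induction n with
    | zero => simp
    | succ n ih =>
      rw [iteratedDeriv_succ, ih]
      funext x
      have h1 : HasDerivAt (fun x : ℝ => Complex.I * (x : ℂ)) (Complex.I * 1) x :=
        (Complex.ofRealCLM.hasDerivAt (x := x)).const_mul Complex.I
      have h2 := (h1.cexp).const_mul (Complex.I ^ n)
      rw [h2.deriv]
      ring
  refine ⟨hsm, fun n => ⟨0, 1, fun x => ?_⟩⟩
  rw [norm_iteratedFDeriv_eq_norm_iteratedDeriv, hd n]
  simp [Complex.norm_exp]

theorem hasTemperateGrowth_chirp (c : ℂ) (p q r : ℝ) :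
    Function.HasTemperateGrowth
      (fun t : ℝ => c * Complex.exp (Complex.I * ((p * t ^ 2 + q * t + r : ℝ) : ℂ))) := by
  have hp : Function.HasTemperateGrowth (fun t : ℝ => p * t ^ 2 + q * t + r) := by
    have hid : Function.HasTemperateGrowth (fun t : ℝ => t) := .id'
    exact (((Function.HasTemperateGrowth.const p).mul (hid.pow 2)).add
      ((Function.HasTemperateGrowth.const q).mul hid)).add (Function.HasTemperateGrowth.const r)
  exact (Function.HasTemperateGrowth.const c).mul (hasTemperateGrowth_cexp_I.comp hp)

/-! ### The space of highly localized functions and Lizorkin distributions -/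

theorem integrable_pow_mul_schwartz (k : ℕ) (φ : 𝓢(ℝ, ℂ)) :
    Integrable (fun x : ℝ => ((x : ℂ) ^ k) * φ x) := by
  have h : Function.HasTemperateGrowth (fun x : ℝ => (x : ℂ) ^ k) :=
    Function.HasTemperateGrowth.pow (by fun_prop) k
  have h2 := (SchwartzMap.smulLeftCLM ℂ (fun x : ℝ => (x : ℂ) ^ k) φ).integrable (μ := volume)
  refine h2.congr (Eventually.of_forall fun x => ?_)
  simp [SchwartzMap.smulLeftCLM_apply_apply h]

/-- `𝓢₀(ℝ)`: the Schwartz functions all of whose moments vanish, with the topology induced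
from `𝓢(ℝ)`. -/
def S0 : Submodule ℂ 𝓢(ℝ, ℂ) where
  carrier := {φ | ∀ k : ℕ, ∫ x : ℝ, ((x : ℂ) ^ k) * φ x = 0}
  zero_mem' := by intro k; simp
  add_mem' := by
    intro φ ψ hφ hψ k
    simp only [add_apply, mul_add]
    rw [integral_add (integrable_pow_mul_schwartz k φ) (integrable_pow_mul_schwartz k ψ),
      hφ k, hψ k, add_zero]
  smul_mem' := by
    intro c φ hφ k
    have : ∀ x : ℝ, ((x : ℂ) ^ k) * (c • φ) x = c * (((x : ℂ) ^ k) * φ x) := by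
      intro x; simp only [smul_apply, smul_eq_mul]; ring
    simp only [this]
    rw [integral_const_mul, hφ k, mul_zero]

/-- `𝓢₀'(ℝ)`: the Lizorkin distributions, i.e. the topological dual of `𝓢₀(ℝ)`. -/
abbrev LizorkinDistribution := S0 →L[ℂ] ℂ

/-- The tempered distribution `F` represents the Lizorkin distribution `f`
(under `𝓢₀'(ℝ) = 𝓢'(ℝ) / {polynomials}`): its restriction to `𝓢₀(ℝ)` is `f`. -/
def Represents (F : 𝓢'(ℝ, ℂ)) (f : LizorkinDistribution) : Prop :=
  ∀ φ : S0, F (φ : 𝓢(ℝ, ℂ)) = f φ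

/-- Every Lizorkin distribution has a tempered representative (Hahn-Banach). -/
theorem exists_represents (f : LizorkinDistribution) : ∃ F : 𝓢'(ℝ, ℂ), Represents F f := by
  have : PolynormableSpace ℂ 𝓢(ℝ, ℂ) := (schwartz_withSeminorms ℂ ℝ ℂ).toPolynormableSpace
  obtain ⟨F, hF⟩ := StrongDual.exists_extension S0 f
  exact ⟨ContinuousLinearMap.toPointwiseConvergenceCLM ℂ (RingHom.id ℂ) 𝓢(ℝ, ℂ) ℂ F,
    fun φ => hF φ⟩

/-! ### Dilation, modulation -/

/-- Dilation `φ_a(t) = φ(a t)` for `a ≠ 0` (and the irrelevant value `0` for `a = 0`). -/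
def dilate (a : ℝ) (φ : 𝓢(ℝ, ℂ)) : 𝓢(ℝ, ℂ) :=
  if h : a = 0 then 0
  else SchwartzMap.compCLMOfContinuousLinearEquiv ℂ
    (ContinuousLinearEquiv.unitsEquivAut ℝ (Units.mk0 a h)) φ

theorem dilate_apply {a : ℝ} (ha : a ≠ 0) (φ : 𝓢(ℝ, ℂ)) (t : ℝ) :
    dilate a φ t = φ (a * t) := by
  simp [dilate, ha, mul_comm]

theorem dilate_mem_S0 (a : ℝ) {φ : 𝓢(ℝ, ℂ)} (hφ : φ ∈ S0) : dilate a φ ∈ S0 := by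
  by_cases ha : a = 0
  · simp only [dilate, ha, dite_true]; exact S0.zero_mem
  intro k
  simp only [dilate_apply ha]
  have h1 : ∀ t : ℝ, ((t : ℂ) ^ k) * φ (a * t)
      = ((a : ℂ) ^ k)⁻¹ * ((((a * t : ℝ) : ℂ) ^ k) * φ (a * t)) := by
    intro t
    have : (a : ℂ) ^ k ≠ 0 := pow_ne_zero _ (by exact_mod_cast ha)
    push_cast
    rw [mul_pow]
    field_simp
  simp only [h1]
  rw [integral_const_mul,
    Measure.integral_comp_mul_left (fun y : ℝ => ((y : ℂ) ^ k) * φ y) a, hφ k]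
  simp

/-- The modulation `M_a φ(t) = e^{i a t} φ(t)` of a Schwartz function. -/
def modulate (a : ℝ) : 𝓢(ℝ, ℂ) →L[ℂ] 𝓢(ℝ, ℂ) :=
  SchwartzMap.smulLeftCLM ℂ (fun t : ℝ => Complex.exp (Complex.I * (a * t)))

theorem modulate_apply (a : ℝ) (φ : 𝓢(ℝ, ℂ)) (t : ℝ) :
    modulate a φ t = Complex.exp (Complex.I * (a * t)) * φ t := by
  have h : Function.HasTemperateGrowth (fun t : ℝ => Complex.exp (Complex.I * (a * t))) := by
    simpa using hasTemperateGrowth_chirp 1 0 a 0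
  simp [modulate, SchwartzMap.smulLeftCLM_apply_apply h]

/-- The modulation of a tempered distribution, `⟨M_a F, φ⟩ = ⟨F, M_a φ⟩`. -/
def modulateDist (a : ℝ) (F : 𝓢'(ℝ, ℂ)) : 𝓢'(ℝ, ℂ) :=
  TemperedDistribution.smulLeftCLM ℂ (fun t : ℝ => Complex.exp (Complex.I * (a * t))) F

theorem modulateDist_apply (a : ℝ) (F : 𝓢'(ℝ, ℂ)) (φ : 𝓢(ℝ, ℂ)) :
    modulateDist a F φ = F (modulate a φ) := rfl

/-! ### The fractional kernel, the FRST and the Stockwell transform -/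

/-- `c₁ = cot α`. -/
def c₁ (α : ℝ) : ℝ := Real.cot α

/-- `c₂ = csc α`. -/
def c₂ (α : ℝ) : ℝ := 1 / Real.sin α

/-- `C_α = √((1 - i c₁) / (2π))`, principal branch. -/
def Cα (α : ℝ) : ℂ := ((1 - Complex.I * c₁ α) / (2 * Real.pi)) ^ (1 / 2 : ℂ)

/-- The fractional kernel `K_α(t, ξ)`, for `α` not an integer multiple of `π`. -/
def fracKernel (α t ξ : ℝ) : ℂ :=
  Cα α * Complex.exp (Complex.I * (((t ^ 2 + ξ ^ 2) / 2 * c₁ α - t * ξ * c₂ α : ℝ) : ℂ))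

theorem hasTemperateGrowth_fracKernel (α ξ : ℝ) :
    Function.HasTemperateGrowth (fun t : ℝ => fracKernel α t ξ) := by
  have h := hasTemperateGrowth_chirp (Cα α) (c₁ α / 2) (-(ξ * c₂ α)) (ξ ^ 2 / 2 * c₁ α)
  have e : (fun t : ℝ => fracKernel α t ξ) = fun t : ℝ => Cα α * Complex.exp (Complex.I *
      ((c₁ α / 2 * t ^ 2 + -(ξ * c₂ α) * t + ξ ^ 2 / 2 * c₁ α : ℝ) : ℂ)) := by
    funext t
    simp only [fracKernel]
    congr 4
    ring
  rw [e]
  exact h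

/-- The kernel `e^{-iξt} / √(2π)` of the Fourier transform. -/
def fourierKernel (t ξ : ℝ) : ℂ :=
  (1 / Real.sqrt (2 * Real.pi) : ℝ) * Complex.exp (-Complex.I * (ξ * t))

theorem hasTemperateGrowth_fourierKernel (ξ : ℝ) :
    Function.HasTemperateGrowth (fun t : ℝ => fourierKernel t ξ) := by
  have h := hasTemperateGrowth_chirp ((1 / Real.sqrt (2 * Real.pi) : ℝ) : ℂ) 0 (-ξ) 0
  have e : (fun t : ℝ => fourierKernel t ξ) = fun t : ℝ =>
      ((1 / Real.sqrt (2 * Real.pi) : ℝ) : ℂ) *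
        Complex.exp (Complex.I * ((0 * t ^ 2 + -ξ * t + 0 : ℝ) : ℂ)) := by
    funext t
    simp only [fourierKernel]
    congr 2
    push_cast
    ring
  rw [e]
  exact h

/-- The function `t ↦ conj (g (ξ (t - x)))`, for `ξ ≠ 0`. -/
def conjWindow (g : 𝓢(ℝ, ℂ)) (x ξ : ℝ) : 𝓢(ℝ, ℂ) :=
  SchwartzMap.postcompCLM (𝕜 := ℝ) (Complex.conjCLE : ℂ →L[ℝ] ℂ)
    (SchwartzMap.compSubConstCLM ℂ x (dilate ξ g))

theorem conjWindow_apply (g : 𝓢(ℝ, ℂ)) (x : ℝ) {ξ : ℝ} (hξ : ξ ≠ 0) (t : ℝ) :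
    conjWindow g x ξ t = (starRingEnd ℂ) (g (ξ * (t - x))) := by
  simp [conjWindow, dilate_apply hξ]

/-- The Schwartz function `t ↦ conj (g (ξ (t - x))) K_α(t, ξ)`. -/
def frstAtom (α : ℝ) (g : 𝓢(ℝ, ℂ)) (x ξ : ℝ) : 𝓢(ℝ, ℂ) :=
  SchwartzMap.smulLeftCLM ℂ (fun t : ℝ => fracKernel α t ξ) (conjWindow g x ξ)

theorem frstAtom_apply (α : ℝ) (g : 𝓢(ℝ, ℂ)) (x : ℝ) {ξ : ℝ} (hξ : ξ ≠ 0) (t : ℝ) :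
    frstAtom α g x ξ t = (starRingEnd ℂ) (g (ξ * (t - x))) * fracKernel α t ξ := by
  simp [frstAtom, SchwartzMap.smulLeftCLM_apply_apply (hasTemperateGrowth_fracKernel α ξ),
    conjWindow_apply g x hξ, mul_comm]

/-- The fractional Stockwell transform (FRST), for `α` not an integer multiple of `π`:
`S_g^α F(x, ξ) = |ξ| ⟨F(t), conj (g (ξ (t - x))) K_α(t, ξ)⟩`. -/
def frst (α : ℝ) (g : 𝓢(ℝ, ℂ)) (F : 𝓢'(ℝ, ℂ)) (x ξ : ℝ) : ℂ :=
  (|ξ| : ℝ) * F (frstAtom α g x ξ)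

/-- The Schwartz function `t ↦ conj (g (ξ (t - x))) e^{-iξt} / √(2π)`. -/
def stAtom (g : 𝓢(ℝ, ℂ)) (x ξ : ℝ) : 𝓢(ℝ, ℂ) :=
  SchwartzMap.smulLeftCLM ℂ (fun t : ℝ => fourierKernel t ξ) (conjWindow g x ξ)

theorem stAtom_apply (g : 𝓢(ℝ, ℂ)) (x : ℝ) {ξ : ℝ} (hξ : ξ ≠ 0) (t : ℝ) :
    stAtom g x ξ t = (starRingEnd ℂ) (g (ξ * (t - x))) * fourierKernel t ξ := by
  simp [stAtom, SchwartzMap.smulLeftCLM_apply_apply (hasTemperateGrowth_fourierKernel ξ),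
    conjWindow_apply g x hξ, mul_comm]

/-- The Stockwell transform:
`S_g F(x, ξ) = (|ξ| / √(2π)) ⟨F(t), conj (g (ξ (t - x))) e^{-iξt}⟩`. -/
def stockwell (g : 𝓢(ℝ, ℂ)) (F : 𝓢'(ℝ, ℂ)) (x ξ : ℝ) : ℂ :=
  (|ξ| : ℝ) * F (stAtom g x ξ)

/-! ### Slowly varying functions and quasiasymptotics at the origin -/

/-- `L` is slowly varying at the origin: (Lebesgue) measurable and positive on some `(0, A]`,
with `L(a ε) / L(ε) → 1` as `ε → 0⁺` for every `a > 0`. -/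
def SlowlyVaryingAtZero (L : ℝ → ℝ) : Prop :=
  (∃ A : ℝ, 0 < A ∧ AEMeasurable L (volume.restrict (Set.Ioc 0 A)) ∧
    ∀ ε ∈ Set.Ioc 0 A, 0 < L ε) ∧
  ∀ a : ℝ, 0 < a → Tendsto (fun ε : ℝ => L (a * ε) / L ε) (𝓝[>] 0) (𝓝 1)

/-- `⟨f(ε x), φ(x)⟩ = ε⁻¹ ⟨f(x), φ(x / ε)⟩` for `ε > 0`. -/
def scaledPairing (f : LizorkinDistribution) (ε : ℝ) (φ : S0) : ℂ :=
  ((ε⁻¹ : ℝ) : ℂ) * f ⟨dilate ε⁻¹ (φ : 𝓢(ℝ, ℂ)), dilate_mem_S0 ε⁻¹ φ.2⟩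

/-- `f(ε x) ∼ ε^m L(ε) u(x)` as `ε → 0⁺` in `𝓢₀'(ℝ)`. -/
def QuasiasymptoticAtZero (f : LizorkinDistribution) (m : ℝ) (L : ℝ → ℝ)
    (u : LizorkinDistribution) : Prop :=
  ∀ φ : S0, Tendsto (fun ε : ℝ => scaledPairing f ε φ / ((ε ^ m * L ε : ℝ) : ℂ))
    (𝓝[>] 0) (𝓝 (u φ))

/-! ### The spaces `𝓢(𝕐)` and `𝓢'(𝕐)`, `𝕐 = ℝ × (ℝ ∖ {0})` -/

/-- `𝕐 = ℝ × (ℝ ∖ {0})`. -/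
def Y : Set (ℝ × ℝ) := {p | p.2 ≠ 0}

/-- The partial derivative `∂_ξ^l ∂_x^m Φ` (at points `(x, ξ)` of `𝕐`). -/
def partialDeriv (l m : ℕ) (Φ : ℝ × ℝ → ℂ) (p : ℝ × ℝ) : ℂ :=
  iteratedDeriv l (fun ξ : ℝ => iteratedDeriv m (fun x : ℝ => Φ (x, ξ)) p.1) p.2

/-- The seminorms
`ρ^{l,m}_{s,r}(Φ) = sup_{(x,ξ) ∈ 𝕐} (|ξ|^s + 1/|ξ|^s) |x^r ∂_ξ^l ∂_x^m Φ(x,ξ)|`,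
with index `i = (s, r, l, m)`. -/
def rhoY (i : ℕ × ℕ × ℕ × ℕ) (Φ : ℝ × ℝ → ℂ) : ℝ≥0∞ :=
  ⨆ p ∈ Y, ENNReal.ofReal
    ((|p.2| ^ i.1 + 1 / |p.2| ^ i.1) *
      ‖((p.1 : ℂ) ^ i.2.1) * partialDeriv i.2.2.1 i.2.2.2 Φ p‖)

/-- `Φ ∈ 𝓢(𝕐)` (only the values of `Φ` on `𝕐` matter). -/
structure IsSchwartzY (Φ : ℝ × ℝ → ℂ) : Prop where
  smooth : ContDiffOn ℝ ∞ Φ Y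
  decay : ∀ i : ℕ × ℕ × ℕ × ℕ, rhoY i Φ < ⊤

/-- The pairing `∫∫_𝕐 G(x,ξ) Φ(x,ξ) dx dξ`. -/
def pairingY (G Φ : ℝ × ℝ → ℂ) : ℂ := ∫ p in Y, G p * Φ p

/-- The function `G` is (defines) an element of `𝓢'(𝕐)`: the pairing `Φ ↦ ∫∫_𝕐 G Φ` is
absolutely convergent and is a continuous functional on `𝓢(𝕐)`. -/
def IsDistributionY (G : ℝ × ℝ → ℂ) : Prop :=
  (∀ Φ, IsSchwartzY Φ → IntegrableOn (fun p => G p * Φ p) Y) ∧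
  ∃ (I : Finset (ℕ × ℕ × ℕ × ℕ)) (C : ℝ≥0), ∀ Φ, IsSchwartzY Φ →
    ‖pairingY G Φ‖ₑ ≤ C * ∑ i ∈ I, rhoY i Φ

/-- `G ε ∼ ν(ε) G₀` as `ε → 0⁺` in `𝓢'(𝕐)`: `G ε` (for small `ε > 0`) and `G₀` are elements of
`𝓢'(𝕐)`, and `G ε / ν(ε) → G₀` weakly. -/
def AsymptoticY (G : ℝ → ℝ × ℝ → ℂ) (ν : ℝ → ℝ) (G₀ : ℝ × ℝ → ℂ) : Prop :=
  (∀ᶠ ε in 𝓝[>] (0 : ℝ), IsDistributionY (G ε)) ∧ IsDistributionY G₀ ∧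
  ∀ Φ, IsSchwartzY Φ →
    Tendsto (fun ε : ℝ => pairingY (G ε) Φ / ((ν ε : ℝ) : ℂ)) (𝓝[>] 0) (𝓝 (pairingY G₀ Φ))

end Stockwell

end

noncomputable section

namespace Stockwell

/-! ### Slowly varying functions -/

/-! Substituting `t = ε s` turns the left-hand side into `C_α ε² |ξ| ⟨f(ε s), e^{iε² q(s)} h(ξ(s -
x))⟩`, where `h` is the conjugate of `g` and `q(s) = c₁ s²/2 - c₂ ξ s`: the window `g_{1/ε²}`
becomes a window independent of `ε`, the prefactor removes the part of the kernel that depends on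
`ξ²`, and the remaining chirp degenerates to `1` as `ε → 0`. Formally the limit is `C_α |ξ| ⟨u,
h(ξ(· - x))⟩`. The right-hand side is the same quantity, since the modulation cancels the Fourier
kernel and a quasiasymptotic limit is homogeneous of degree `m`, which accounts for the powers of
`c₂`.

The difficulty is that chirp times window need not lie in `𝓢₀`, where alone the hypothesis gives
information. So `e^{iε² q}` is expanded to order `N`. Each Taylor term `q^j h(ξ(s - x))` is a
polynomial times an element of `𝓢₀`, hence in `𝓢₀`, and carries the factor `ε^{2j}`, so that only `j
= 0` survives. The remainder is `ε^{2N}` times a Schwartz function bounded uniformly in `ε`. Any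
tempered representative loses only a fixed power `ε^{-K}` under dilation, and a slowly varying `L`
is at least `c ε²` near `0`; a large `N` therefore makes the remainder `o(ε^m L(ε))`. This also
covers the freedom in the choice of representatives.

The passage from pointwise limits to limits in `𝓢'(𝕐)` is dominated convergence. The dominating
function is a power of `1 + |x| + |ξ| + |ξ|⁻¹`. It comes from Banach–Steinhaus on the Fréchet space
`𝓢₀` for the Taylor terms (`exists_norm_taylor_sum_le`) and from seminorm estimates for parametrized
Schwartz families for the remainder (`exists_remainder_bound`). -/

theorem nullMeasurableSet_preimage_const_mul {a : ℝ} (ha : a ≠ 0) {T : Set ℝ}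
    (hT : NullMeasurableSet T) : NullMeasurableSet ((a * ·) ⁻¹' T) := by
  refine hT.preimage ⟨by fun_prop, ?_⟩
  rw [Real.map_volume_mul_left ha]
  exact Measure.smul_absolutelyContinuous

/-- A one-sided form of the uniform convergence theorem for slowly varying functions, by a measure
argument. If it failed along `e n → 0` with factors `l n`, the values `L (e n)` and `L (l n * e n)`
could both be compared with `L (y * e n)` for most `y`; a single `y` serving both comparisons
contradicts the failure. -/
theorem SlowlyVaryingAtZero.exists_le_four_mul {L : ℝ → ℝ} (hL : SlowlyVaryingAtZero L) :
    ∃ δ : ℝ, 0 < δ ∧ ∀ ε ∈ Set.Ioc 0 δ, 0 < L ε ∧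
      ∀ l ∈ Set.Icc (1 / 2 : ℝ) 1, L ε ≤ 4 * L (l * ε) := by
  obtain ⟨⟨A, hA, hmeas, hpos⟩, hlim⟩ := hL
  have key : ∃ δ : ℝ, 0 < δ ∧ δ ≤ A ∧ ∀ ε ∈ Set.Ioc 0 δ,
      ∀ l ∈ Set.Icc (1 / 2 : ℝ) 1, L ε ≤ 4 * L (l * ε) := by
    by_contra! hcon
    -- The bound `A / 5` keeps `y * e n` inside `(0, A]` for every `y ∈ [1, 5]`.
    have hex : ∀ n : ℕ, ∃ e ∈ Set.Ioc 0 (A / 5 / ((n : ℝ) + 1)), ∃ l ∈ Set.Icc (1 / 2 : ℝ) 1,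
        4 * L (l * e) < L e := fun n => by
      refine hcon _ (by positivity) ?_
      have h1 : (1 : ℝ) ≤ (n : ℝ) + 1 := by simp
      exact (div_le_self (by positivity) h1).trans (by linarith)
    choose e he l hl hbad using hex
    have he0 : ∀ n, 0 < e n := fun n => (he n).1
    have heA : ∀ n, e n ≤ A / 5 := fun n => (he n).2.trans
      (div_le_self (by positivity) (by simp))
    have hlim0 : Tendsto (fun n : ℕ => A / 5 / ((n : ℝ) + 1)) atTop (𝓝 0) :=
      tendsto_const_div_atTop_nhds_zero_nat (A / 5) |>.comp (tendsto_add_atTop_nat 1) |>.congr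
        (fun n => by simp)
    have het : Tendsto e atTop (𝓝[>] 0) := tendsto_nhdsWithin_iff.2
      ⟨squeeze_zero (fun n => (he0 n).le) (fun n => (he n).2) hlim0,
        Eventually.of_forall fun n => he0 n⟩
    have hl0 : ∀ n, 0 < l n := fun n => lt_of_lt_of_le (by norm_num) (hl n).1
    have hle0 : ∀ n, 0 < l n * e n := fun n => mul_pos (hl0 n) (he0 n)
    have hlee : ∀ n, l n * e n ≤ e n := fun n => mul_le_of_le_one_left (he0 n).le (hl n).2
    have hlet : Tendsto (fun n => l n * e n) atTop (𝓝[>] 0) := tendsto_nhdsWithin_iff.2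
      ⟨squeeze_zero (fun n => (hle0 n).le) hlee (tendsto_nhdsWithin_iff.1 het).1,
        Eventually.of_forall fun n => hle0 n⟩
    let V : ℕ → Set ℝ := fun n => {y ∈ Set.Icc (1 : ℝ) 5 | ∀ k ≥ n, L (e k) ≤ 2 * L (y * e k)}
    let W : ℕ → Set ℝ := fun n => {y ∈ Set.Icc (1 : ℝ) 5 |
      ∀ k ≥ n, L (y * (l k * e k)) ≤ 2 * L (l k * e k)}
    have hVm : Monotone V := fun n n' h y hy => ⟨hy.1, fun k hk => hy.2 k (h.trans hk)⟩
    have hWm : Monotone W := fun n n' h y hy => ⟨hy.1, fun k hk => hy.2 k (h.trans hk)⟩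
    have hVU : (⋃ n, V n) = Set.Icc 1 5 := by
      refine Set.Subset.antisymm (Set.iUnion_subset fun n y hy => hy.1) fun y hy => ?_
      have h1 := ((hlim y (by linarith [hy.1])).comp het).eventually
        (lt_mem_nhds (show (1 / 2 : ℝ) < 1 by norm_num))
      obtain ⟨n, hn⟩ := eventually_atTop.1 h1
      refine Set.mem_iUnion.2 ⟨n, hy, fun k hk => ?_⟩
      have h2 := hn k hk
      have h3 : 0 < L (e k) := hpos _ ⟨he0 k, (heA k).trans (by linarith)⟩
      simp only [Function.comp] at h2
      rw [lt_div_iff₀ h3] at h2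
      linarith
    have hWU : (⋃ n, W n) = Set.Icc 1 5 := by
      refine Set.Subset.antisymm (Set.iUnion_subset fun n y hy => hy.1) fun y hy => ?_
      have h1 := ((hlim y (by linarith [hy.1])).comp hlet).eventually
        (gt_mem_nhds (show (1 : ℝ) < 2 by norm_num))
      obtain ⟨n, hn⟩ := eventually_atTop.1 h1
      refine Set.mem_iUnion.2 ⟨n, hy, fun k hk => ?_⟩
      have h2 := hn k hk
      have h3 : 0 < L (l k * e k) :=
        hpos _ ⟨hle0 k, (hlee k).trans ((heA k).trans (by linarith))⟩
      simp only [Function.comp] at h2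
      rw [div_lt_iff₀ h3] at h2
      exact h2.le
    have hvol : volume (Set.Icc (1 : ℝ) 5) = 4 := by
      rw [Real.volume_Icc]; norm_num
    have hV := tendsto_measure_iUnion_atTop (μ := volume) hVm
    have hW := tendsto_measure_iUnion_atTop (μ := volume) hWm
    rw [hVU, hvol] at hV
    rw [hWU, hvol] at hW
    have h34 : (3 : ℝ≥0∞) < 4 := by norm_num
    obtain ⟨n, hn1, hn2⟩ := ((hV.eventually (lt_mem_nhds h34)).and
      (hW.eventually (lt_mem_nhds h34))).exists
    simp only [Function.comp] at hn1 hn2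
    -- Additivity of the measure on the disjoint union below needs only one of the two sets to be
    -- measurable, so `W n` requires no such argument.
    have hVnull : NullMeasurableSet (V n) := by
      have hT : ∀ k, NullMeasurableSet {t ∈ Set.Ioc 0 A | L (e k) / 2 ≤ L t} := fun k => by
        have := (nullMeasurableSet_le (μ := volume.restrict (Set.Ioc 0 A))
          (aemeasurable_const (b := L (e k) / 2)) hmeas)
        rw [nullMeasurableSet_restrict measurableSet_Ioc.nullMeasurableSet] at this
        rw [Set.inter_comm] at this
        exact this
      have hVeq : V n = Set.Icc 1 5 ∩ ⋂ k, ⋂ (_ : n ≤ k),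
          (e k * ·) ⁻¹' {t ∈ Set.Ioc 0 A | L (e k) / 2 ≤ L t} := by
        ext y
        simp only [V, Set.mem_ofPred_eq, Set.mem_inter_iff, Set.mem_iInter, Set.mem_preimage]
        refine and_congr_right fun hy => forall₂_congr fun k _ => ?_
        have h1 : 0 < e k * y := mul_pos (he0 k) (by linarith [hy.1])
        have h2 : e k * y ≤ A := by nlinarith [hy.2, heA k, he0 k]
        rw [mul_comm y]
        constructor
        · intro h
          exact ⟨⟨h1, h2⟩, by linarith⟩
        · intro h
          linarith [h.2]
      rw [hVeq]
      exact measurableSet_Icc.nullMeasurableSet.inter (NullMeasurableSet.iInter fun k =>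
        NullMeasurableSet.iInter fun _ => nullMeasurableSet_preimage_const_mul (he0 k).ne' (hT k))
    let X : Set ℝ := ((l n)⁻¹ * ·) ⁻¹' W n
    have hXvol : volume X = ENNReal.ofReal (l n) * volume (W n) := by
      rw [Real.volume_preimage_mul_left (inv_ne_zero (hl0 n).ne'), inv_inv, abs_of_pos (hl0 n)]
    -- A common point `y` would give `L (e n) ≤ 2 L (y e n) ≤ 4 L (l n * e n)`, against `hbad`.
    have hdisj : Disjoint (V n) X := by
      rw [Set.disjoint_left]
      intro y hy hyX
      have h1 := hy.2 n le_rfl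
      have h2 := hyX.2 n le_rfl
      have h3 : (l n)⁻¹ * y * (l n * e n) = y * e n := by
        field_simp [(hl0 n).ne']
      simp only [h3] at h2
      linarith [hbad n]
    have hsub : V n ∪ X ⊆ Set.Icc (1 / 2) 5 := by
      rintro y (hy | hy)
      · exact ⟨by linarith [hy.1.1], hy.1.2⟩
      · have h1 : 1 ≤ (l n)⁻¹ * y := hy.1.1
        have h2 : (l n)⁻¹ * y ≤ 5 := hy.1.2
        rw [inv_mul_eq_div, le_div_iff₀ (hl0 n)] at h1
        rw [inv_mul_eq_div, div_le_iff₀ (hl0 n)] at h2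
        exact ⟨by linarith [(hl n).1], by linarith [(hl n).2]⟩
    -- The two sets fit into `[1/2, 5]`, of length `9/2`, while their measures exceed `3` and are at
    -- least `3/2` respectively.
    have hle : volume (V n) + volume X ≤ ENNReal.ofReal (9 / 2) := by
      rw [← measure_union₀' hVnull hdisj.aedisjoint]
      refine (measure_mono hsub).trans ?_
      rw [Real.volume_Icc]
      norm_num
    have hX : ENNReal.ofReal (3 / 2) ≤ volume X := by
      rw [hXvol]
      calc ENNReal.ofReal (3 / 2) = ENNReal.ofReal (1 / 2) * 3 := by
            rw [← ENNReal.ofReal_ofNat 3, ← ENNReal.ofReal_mul (by norm_num)]; norm_num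
        _ ≤ _ := mul_le_mul' (ENNReal.ofReal_le_ofReal (hl n).1) hn2.le
    have hlt : ENNReal.ofReal (9 / 2) < volume (V n) + volume X := by
      calc ENNReal.ofReal (9 / 2) = 3 + ENNReal.ofReal (3 / 2) := by
            rw [← ENNReal.ofReal_ofNat 3, ← ENNReal.ofReal_add (by norm_num) (by norm_num)]
            norm_num
        _ < volume (V n) + ENNReal.ofReal (3 / 2) :=
            ENNReal.add_lt_add_right ENNReal.ofReal_ne_top hn1
        _ ≤ _ := by gcongr
    exact absurd hle (not_le.2 hlt)
  obtain ⟨δ, hδ, hδA, h⟩ := key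
  exact ⟨δ, hδ, fun ε hε => ⟨hpos _ ⟨hε.1, hε.2.trans hδA⟩, h ε hε⟩⟩

/-- A slowly varying function decays at `0` at most polynomially. -/
theorem SlowlyVaryingAtZero.exists_sq_le {L : ℝ → ℝ} (hL : SlowlyVaryingAtZero L) :
    ∃ δ c : ℝ, 0 < δ ∧ 0 < c ∧ ∀ ε ∈ Set.Ioc 0 δ, c * ε ^ 2 ≤ L ε := by
  obtain ⟨δ, hδ, h⟩ := hL.exists_le_four_mul
  have hLδ : 0 < L δ := (h δ ⟨hδ, le_rfl⟩).1
  -- Iterating `L (2ε) ≤ 4 L ε` along dyadic scales loses `4 = 2²` per halving, whence the exponent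
  -- `2`. The extra factor `4` absorbs the last, incomplete halving in `(δ/2, δ]`.
  have step : ∀ n : ℕ, ∀ ε ∈ Set.Ioc 0 δ, δ ≤ 2 ^ n * ε →
      L δ * ε ^ 2 ≤ 4 * δ ^ 2 * L ε := by
    intro n
    induction n with
    | zero =>
      intro ε hε hle
      have : ε = δ := le_antisymm hε.2 (by simpa using hle)
      subst this
      nlinarith [mul_pos (pow_pos hδ 2) hLδ]
    | succ n ih =>
      intro ε hε hle
      by_cases h2 : 2 * ε ≤ δ
      · have h3 := ih (2 * ε) ⟨by linarith [hε.1], h2⟩ (by rw [pow_succ] at hle; linarith)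
        have h4 := (h (2 * ε) ⟨by linarith [hε.1], h2⟩).2 (1 / 2) (by norm_num)
        rw [show 1 / 2 * (2 * ε) = ε by ring] at h4
        nlinarith [mul_le_mul_of_nonneg_left h4 (show 0 ≤ 4 * δ ^ 2 by positivity)]
      · have hl : ε / δ ∈ Set.Icc (1 / 2 : ℝ) 1 :=
          ⟨by rw [le_div_iff₀ hδ]; linarith, by rw [div_le_one hδ]; exact hε.2⟩
        have h4 := (h δ ⟨hδ, le_rfl⟩).2 _ hl
        rw [div_mul_cancel₀ _ hδ.ne'] at h4
        have h5 : ε ^ 2 ≤ δ ^ 2 := pow_le_pow_left₀ hε.1.le hε.2 2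
        nlinarith [mul_le_mul_of_nonneg_left h5 hLδ.le,
          mul_le_mul_of_nonneg_left h4 (show 0 ≤ δ ^ 2 by positivity)]
  refine ⟨δ, L δ / (4 * δ ^ 2), hδ, by positivity, fun ε hε => ?_⟩
  obtain ⟨n, hn⟩ := pow_unbounded_of_one_lt (δ / ε) (one_lt_two)
  have := step n ε hε (by rw [div_lt_iff₀ hε.1] at hn; exact hn.le)
  rw [div_mul_eq_mul_div, div_le_iff₀ (by positivity)]
  linarith

theorem SlowlyVaryingAtZero.eventually_pos {L : ℝ → ℝ} (hL : SlowlyVaryingAtZero L) :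
    ∀ᶠ ε in 𝓝[>] (0 : ℝ), 0 < L ε := by
  obtain ⟨⟨A, hA, -, hpos⟩, -⟩ := hL
  filter_upwards [Ioc_mem_nhdsGT hA] with ε hε using hpos ε hε

/-! ### Completeness of the Schwartz space and uniform boundedness -/

theorem hasDerivAt_iteratedDeriv_schwartz (φ : 𝓢(ℝ, ℂ)) (n : ℕ) (x : ℝ) :
    HasDerivAt (iteratedDeriv n φ) (iteratedDeriv (n + 1) φ x) x := by
  have h : ContDiff ℝ ((n + 1 : ℕ) : ℕ∞ω) φ := mod_cast φ.smooth (n + 1 : ℕ)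
  rw [iteratedDeriv_succ]
  exact ((h.differentiable_iteratedDeriv n (by exact_mod_cast Nat.lt_succ_self n)) x).hasDerivAt

theorem iteratedDeriv_sub_schwartz (φ ψ : 𝓢(ℝ, ℂ)) (n : ℕ) (x : ℝ) :
    iteratedDeriv n (φ - ψ : 𝓢(ℝ, ℂ)) x = iteratedDeriv n φ x - iteratedDeriv n ψ x := by
  have h : ((φ - ψ : 𝓢(ℝ, ℂ)) : ℝ → ℂ) = (φ : ℝ → ℂ) - ψ := by ext; simp
  rw [h]
  exact iteratedDeriv_sub ((φ.smooth n).contDiffAt) ((ψ.smooth n).contDiffAt)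

theorem iteratedDeriv_eq_of_hasDerivAt {h : ℕ → ℝ → ℂ}
    (hd : ∀ n x, HasDerivAt (h n) (h (n + 1) x) x) (n : ℕ) : iteratedDeriv n (h 0) = h n := by
  induction n with
  | zero => simp
  | succ n ih => rw [iteratedDeriv_succ, ih]; exact funext fun x => (hd n x).deriv

/-- A Schwartz function from its tower of derivatives. -/
def schwartzOfTower (h : ℕ → ℝ → ℂ) (hd : ∀ n x, HasDerivAt (h n) (h (n + 1) x) x)
    (hb : ∀ k n : ℕ, ∃ C, ∀ x, |x| ^ k * ‖h n x‖ ≤ C) : 𝓢(ℝ, ℂ) where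
  toFun := h 0
  smooth' := contDiff_of_differentiable_iteratedDeriv fun n _ => by
    rw [iteratedDeriv_eq_of_hasDerivAt hd]
    exact fun x => (hd n x).differentiableAt
  decay' := fun k n => by
    obtain ⟨C, hC⟩ := hb k n
    refine ⟨C, fun x => ?_⟩
    rw [norm_iteratedFDeriv_eq_norm_iteratedDeriv, iteratedDeriv_eq_of_hasDerivAt hd]
    exact hC x

/-- All derivatives of a Cauchy sequence converge uniformly, so their limits form a tower of
derivatives; letting the second index tend to infinity in the weighted Cauchy estimates gives both
rapid decay and convergence in every seminorm. -/
instance : CompleteSpace 𝓢(ℝ, ℂ) := by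
  have : (uniformity 𝓢(ℝ, ℂ)).IsCountablyGenerated :=
    IsUniformAddGroup.uniformity_countably_generated
  refine UniformSpace.complete_of_cauchySeq_tendsto fun u hu => ?_
  have hsemi : ∀ k n : ℕ, ∀ ε > 0, ∃ N, ∀ i ≥ N, ∀ j ≥ N, ∀ x,
      |x| ^ k * ‖iteratedDeriv n (u i) x - iteratedDeriv n (u j) x‖ < ε := by
    intro k n ε hε
    have hcont := (schwartz_withSeminorms ℂ ℝ ℂ).continuous_seminorm (k, n)
    have hV : {v : 𝓢(ℝ, ℂ) | SchwartzMap.seminorm ℂ k n v < ε} ∈ 𝓝 (0 : 𝓢(ℝ, ℂ)) := by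
      refine (hcont.tendsto 0).eventually (gt_mem_nhds ?_)
      simpa using hε
    have hU : (fun p : 𝓢(ℝ, ℂ) × 𝓢(ℝ, ℂ) => p.2 - p.1) ⁻¹'
        {v : 𝓢(ℝ, ℂ) | SchwartzMap.seminorm ℂ k n v < ε} ∈ uniformity 𝓢(ℝ, ℂ) := by
      rw [uniformity_eq_comap_nhds_zero]
      exact preimage_mem_comap hV
    obtain ⟨N, hN⟩ := hu.mem_entourage hU
    refine ⟨N, fun i hi j hj x => ?_⟩
    rw [← iteratedDeriv_sub_schwartz]
    exact (SchwartzMap.le_seminorm' ℂ k n _ x).trans_lt (hN j i hj hi)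
  have hcau : ∀ n, UniformCauchySeqOn (fun i => iteratedDeriv n (u i)) atTop Set.univ := by
    intro n
    rw [Metric.uniformCauchySeqOn_iff]
    intro ε hε
    obtain ⟨N, hN⟩ := hsemi 0 n ε hε
    refine ⟨N, fun i hi j hj x _ => ?_⟩
    simpa [dist_eq_norm] using hN i hi j hj x
  have hlim : ∀ n x, ∃ y, Tendsto (fun i => iteratedDeriv n (u i) x) atTop (𝓝 y) := fun n x =>
    cauchySeq_tendsto_of_complete ((hcau n).cauchySeq (Set.mem_univ x))
  choose h hh using hlim
  have hunif : ∀ n, TendstoUniformly (fun i => iteratedDeriv n (u i)) (h n) atTop := fun n =>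
    tendstoUniformlyOn_univ.1 ((hcau n).tendstoUniformlyOn_of_tendsto fun x _ => hh n x)
  have hd : ∀ n x, HasDerivAt (h n) (h (n + 1) x) x := fun n =>
    hasDerivAt_of_tendstoUniformly (hunif (n + 1))
      (Eventually.of_forall fun i x => hasDerivAt_iteratedDeriv_schwartz (u i) n x) (hh n)
  have hclose : ∀ k n : ℕ, ∀ ε > 0, ∃ N, ∀ i ≥ N, ∀ x,
      |x| ^ k * ‖iteratedDeriv n (u i) x - h n x‖ ≤ ε := by
    intro k n ε hε
    obtain ⟨N, hN⟩ := hsemi k n ε hε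
    refine ⟨N, fun i hi x => ?_⟩
    refine le_of_tendsto ((tendsto_const_nhds.sub (hh n x)).norm.const_mul _)
      (eventually_atTop.2 ⟨N, fun j hj => (hN i hi j hj x).le⟩)
  have hb : ∀ k n : ℕ, ∃ C, ∀ x, |x| ^ k * ‖h n x‖ ≤ C := by
    intro k n
    obtain ⟨N, hN⟩ := hclose k n 1 one_pos
    refine ⟨SchwartzMap.seminorm ℂ k n (u N) + 1, fun x => ?_⟩
    have h1 := SchwartzMap.le_seminorm' ℂ k n (u N) x
    have h2 := hN N le_rfl x
    have h3 : ‖h n x‖ ≤ ‖iteratedDeriv n (u N) x‖ + ‖iteratedDeriv n (u N) x - h n x‖ := by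
      have := norm_sub_le (iteratedDeriv n (u N) x) (iteratedDeriv n (u N) x - h n x)
      simpa using this
    calc _ ≤ |x| ^ k * (‖iteratedDeriv n (u N) x‖ + ‖iteratedDeriv n (u N) x - h n x‖) := by
          gcongr
      _ ≤ _ := by rw [mul_add]; exact add_le_add h1 h2
  refine ⟨schwartzOfTower h hd hb, ?_⟩
  rw [(schwartz_withSeminorms ℂ ℝ ℂ).tendsto_nhds_atTop]
  rintro ⟨k, n⟩ ε hε
  obtain ⟨N, hN⟩ := hclose k n (ε / 2) (by positivity)
  refine ⟨N, fun i hi => lt_of_le_of_lt ?_ (half_lt_self hε)⟩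
  refine SchwartzMap.seminorm_le_bound' ℂ k n _ (by positivity) fun x => ?_
  rw [iteratedDeriv_sub_schwartz]
  have : iteratedDeriv n (schwartzOfTower h hd hb) x = h n x :=
    congrFun (iteratedDeriv_eq_of_hasDerivAt hd n) x
  rw [this]
  exact hN i hi x

instance : IsUniformAddGroup S0 := S0.toAddSubgroup.isUniformAddGroup

/-- The `k`-th moment as a continuous functional. -/
def momentCLM (k : ℕ) : 𝓢(ℝ, ℂ) →L[ℂ] ℂ :=
  (SchwartzMap.integralCLM ℂ volume).comp (SchwartzMap.smulLeftCLM ℂ fun x : ℝ => (x : ℂ) ^ k)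

theorem momentCLM_apply (k : ℕ) (φ : 𝓢(ℝ, ℂ)) :
    momentCLM k φ = ∫ x : ℝ, (x : ℂ) ^ k * φ x := by
  have h : Function.HasTemperateGrowth (fun x : ℝ => (x : ℂ) ^ k) :=
    Function.HasTemperateGrowth.pow (by fun_prop) k
  simp [momentCLM, SchwartzMap.integralCLM_apply, SchwartzMap.smulLeftCLM_apply_apply h]

theorem isClosed_S0 : IsClosed (S0 : Set 𝓢(ℝ, ℂ)) := by
  have : (S0 : Set 𝓢(ℝ, ℂ)) = ⋂ k, (momentCLM k) ⁻¹' {0} := by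
    ext φ
    simp only [Set.mem_iInter, Set.mem_preimage, Set.mem_singleton_iff, momentCLM_apply]
    rfl
  rw [this]
  exact isClosed_iInter fun k => isClosed_singleton.preimage (momentCLM k).continuous

instance : CompleteSpace S0 := isClosed_S0.completeSpace_coe

/-- Completeness and a countably generated uniformity make `S0` a Baire space, which is what the
uniform boundedness principle needs. -/
instance : BarrelledSpace ℂ S0 := by
  have : (uniformity 𝓢(ℝ, ℂ)).IsCountablyGenerated :=
    IsUniformAddGroup.uniformity_countably_generated
  have : (uniformity S0).IsCountablyGenerated := by
    rw [uniformity_subtype]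
    exact Filter.comap.isCountablyGenerated _ _
  have : BaireSpace S0 := inferInstance
  exact BaireSpace.instBarrelledSpace

theorem schwartz_withSeminorms_S0 :
    WithSeminorms ((schwartzSeminormFamily ℂ ℝ ℂ).comp S0.subtype) :=
  Topology.IsInducing.withSeminorms (schwartz_withSeminorms ℂ ℝ ℂ) Topology.IsInducing.subtypeVal

/-- Uniform boundedness principle on `𝓢₀(ℝ)`. -/
theorem exists_bound_of_pointwise_bounded {ι : Type*} (T : ι → LizorkinDistribution)
    (hT : ∀ φ, ∃ C, ∀ i, ‖T i φ‖ ≤ C) :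
    ∃ (s : Finset (ℕ × ℕ)) (C : ℝ), 0 ≤ C ∧ ∀ i (φ : S0),
      ‖T i φ‖ ≤ C * (s.sup (schwartzSeminormFamily ℂ ℝ ℂ)) (φ : 𝓢(ℝ, ℂ)) := by
  have hq := norm_withSeminorms ℂ ℂ
  have hue := WithSeminorms.banach_steinhaus (𝓕 := T) hq fun _ φ => by
    obtain ⟨C, hC⟩ := hT φ
    exact ⟨C, by rintro _ ⟨i, rfl⟩; exact hC i⟩
  have htfae : UniformEquicontinuous _ ↔ ∀ _, ∃ p : Seminorm ℂ S0, Continuous p ∧ _ :=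
    (hq.equicontinuous_TFAE fun i => (T i : S0 →ₗ[ℂ] ℂ)).out 2 3
  obtain ⟨p, hp, hle⟩ := htfae.1 hue 0
  obtain ⟨s, C, -, hsC⟩ := Seminorm.bound_of_continuous schwartz_withSeminorms_S0 p hp
  refine ⟨s, C, C.2, fun i φ => ((hle i) φ).trans ((hsC φ).trans (le_of_eq ?_))⟩
  rw [← SeminormFamily.finset_sup_comp]
  rfl

theorem exists_bound_temperedDistribution (F : 𝓢'(ℝ, ℂ)) :
    ∃ (s : Finset (ℕ × ℕ)) (C : ℝ), 0 ≤ C ∧ ∀ φ : 𝓢(ℝ, ℂ),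
      ‖F φ‖ ≤ C * (s.sup (schwartzSeminormFamily ℂ ℝ ℂ)) φ := by
  let p : Seminorm ℂ 𝓢(ℝ, ℂ) := (normSeminorm ℂ ℂ).comp
    ({ toFun := F, map_add' := map_add F, map_smul' := map_smul F } : 𝓢(ℝ, ℂ) →ₗ[ℂ] ℂ)
  have hp : Continuous p := (map_continuous F).norm
  obtain ⟨s, C, -, hsC⟩ := Seminorm.bound_of_continuous (schwartz_withSeminorms ℂ ℝ ℂ) p hp
  exact ⟨s, C, C.2, fun φ => hsC φ⟩

/-! ### Families of functions with polynomial bounds in a parameter -/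

section Families

variable {Z : Type*}

/-- `φ` is `n` times differentiable in its last variable, with derivatives satisfying `P`. -/
def DerivTower (P : (Z → ℝ → ℂ) → Prop) : ℕ → (Z → ℝ → ℂ) → Prop
  | 0, φ => P φ
  | n + 1, φ => P φ ∧ ∃ φ' : Z → ℝ → ℂ, (∀ z t, HasDerivAt (φ z) (φ' z t) t) ∧ DerivTower P n φ'

theorem DerivTower.base {P : (Z → ℝ → ℂ) → Prop} {n : ℕ} {φ : Z → ℝ → ℂ}
    (h : DerivTower P n φ) : P φ := by
  cases n with
  | zero => exact h
  | succ n => exact h.1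

theorem DerivTower.of_succ {P : (Z → ℝ → ℂ) → Prop} {n : ℕ} {φ : Z → ℝ → ℂ}
    (h : DerivTower P (n + 1) φ) : DerivTower P n φ := by
  induction n generalizing φ with
  | zero => exact h.1
  | succ n ih =>
    obtain ⟨h0, φ', h1, h2⟩ := h
    exact ⟨h0, φ', h1, ih h2⟩

theorem DerivTower.add {P : (Z → ℝ → ℂ) → Prop}
    (hP : ∀ φ ψ, P φ → P ψ → P fun z t => φ z t + ψ z t) {n : ℕ} {φ ψ : Z → ℝ → ℂ}
    (hφ : DerivTower P n φ) (hψ : DerivTower P n ψ) :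
    DerivTower P n fun z t => φ z t + ψ z t := by
  induction n generalizing φ ψ with
  | zero => exact hP φ ψ hφ hψ
  | succ n ih =>
    obtain ⟨h0, φ', h1, h2⟩ := hφ
    obtain ⟨k0, ψ', k1, k2⟩ := hψ
    exact ⟨hP φ ψ h0 k0, _, fun z t => (h1 z t).add (k1 z t), ih h2 k2⟩

/-- Induction on the product rule replaces the full Leibniz formula. Three classes are allowed so
that temperate times rapidly decaying is covered as well. -/
theorem DerivTower.mul {P Q R : (Z → ℝ → ℂ) → Prop}
    (hPQ : ∀ φ ψ, P φ → Q ψ → R fun z t => φ z t * ψ z t)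
    (hR : ∀ φ ψ, R φ → R ψ → R fun z t => φ z t + ψ z t) {n : ℕ} {φ ψ : Z → ℝ → ℂ}
    (hφ : DerivTower P n φ) (hψ : DerivTower Q n ψ) :
    DerivTower R n fun z t => φ z t * ψ z t := by
  induction n generalizing φ ψ with
  | zero => exact hPQ φ ψ hφ hψ
  | succ n ih =>
    have hφ' := hφ.of_succ
    have hψ' := hψ.of_succ
    obtain ⟨h0, φ', h1, h2⟩ := hφ
    obtain ⟨k0, ψ', k1, k2⟩ := hψ
    exact ⟨hPQ φ ψ h0 k0, _, fun z t => (h1 z t).mul (k1 z t),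
      DerivTower.add hR (ih h2 hψ') (ih hφ' k2)⟩

theorem DerivTower.iteratedDeriv {P : (Z → ℝ → ℂ) → Prop} {n : ℕ} {φ : Z → ℝ → ℂ}
    (h : DerivTower P n φ) : P fun z => iteratedDeriv n (φ z) := by
  induction n generalizing φ with
  | zero => simpa using h.base
  | succ n ih =>
    obtain ⟨-, φ', h1, h2⟩ := h
    have : ∀ z, deriv (φ z) = φ' z := fun z => funext fun t => (h1 z t).deriv
    simp only [iteratedDeriv_succ', this]
    exact ih h2

theorem DerivTower.hasDerivAt_iteratedDeriv {P : (Z → ℝ → ℂ) → Prop} {n : ℕ} {φ : Z → ℝ → ℂ}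
    (h : DerivTower P (n + 1) φ) (z : Z) (t : ℝ) :
    HasDerivAt (_root_.iteratedDeriv n (φ z)) (_root_.iteratedDeriv (n + 1) (φ z) t) t := by
  induction n generalizing φ with
  | zero =>
    obtain ⟨-, φ', h1, h2⟩ := h
    simpa [iteratedDeriv_one, (h1 z t).deriv] using h1 z t
  | succ n ih =>
    obtain ⟨-, φ', h1, h2⟩ := h
    have : deriv (φ z) = φ' z := funext fun t => (h1 z t).deriv
    rw [iteratedDeriv_succ', iteratedDeriv_succ' (n := n + 1), this]
    exact ih h2

variable [TopologicalSpace Z]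

/-- Joint continuity and polynomial growth. -/
def TemperateBound (w : Z → ℝ) (φ : Z → ℝ → ℂ) : Prop :=
  Continuous (fun p : Z × ℝ => φ p.1 p.2) ∧
    ∃ (C : ℝ) (M : ℕ), 0 ≤ C ∧ ∀ z t, ‖φ z t‖ ≤ C * w z ^ M * (1 + |t|) ^ M

/-- Joint continuity and rapid decay in the last variable, with polynomial growth in the
parameter. -/
def RapidBound (w : Z → ℝ) (φ : Z → ℝ → ℂ) : Prop :=
  Continuous (fun p : Z × ℝ => φ p.1 p.2) ∧
    ∀ k : ℕ, ∃ (C : ℝ) (M : ℕ), 0 ≤ C ∧ ∀ z t, (1 + |t|) ^ k * ‖φ z t‖ ≤ C * w z ^ M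

/-- A family of functions of temperate growth, with all bounds polynomial in `w`. -/
def TemperateFamily (w : Z → ℝ) (φ : Z → ℝ → ℂ) : Prop :=
  ∀ n, DerivTower (TemperateBound w) n φ

/-- A family of Schwartz functions, with all bounds polynomial in `w`. -/
def SchwartzFamily (w : Z → ℝ) (φ : Z → ℝ → ℂ) : Prop :=
  ∀ n, DerivTower (RapidBound w) n φ

variable {w : Z → ℝ}

theorem TemperateBound.add (hw : ∀ z, 1 ≤ w z) {φ ψ : Z → ℝ → ℂ} (hφ : TemperateBound w φ)
    (hψ : TemperateBound w ψ) : TemperateBound w fun z t => φ z t + ψ z t := by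
  obtain ⟨h0, C, M, hC, h⟩ := hφ
  obtain ⟨k0, D, N, hD, k⟩ := hψ
  refine ⟨h0.add k0, C + D, M + N, by positivity, fun z t => (norm_add_le _ _).trans ?_⟩
  have h1 := hw z
  have h2 : 1 ≤ 1 + |t| := by simp
  rw [add_mul, add_mul]
  refine add_le_add ((h z t).trans ?_) ((k z t).trans ?_)
  · gcongr <;> first | assumption | omega
  · gcongr <;> first | assumption | omega

theorem TemperateBound.mul {φ ψ : Z → ℝ → ℂ} (hw : ∀ z, 1 ≤ w z) (hφ : TemperateBound w φ)
    (hψ : TemperateBound w ψ) : TemperateBound w fun z t => φ z t * ψ z t := by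
  obtain ⟨h0, C, M, hC, h⟩ := hφ
  obtain ⟨k0, D, N, hD, k⟩ := hψ
  refine ⟨h0.mul k0, C * D, M + N, by positivity, fun z t => ?_⟩
  have h1 := hw z
  rw [norm_mul]
  calc ‖φ z t‖ * ‖ψ z t‖ ≤ (C * w z ^ M * (1 + |t|) ^ M) * (D * w z ^ N * (1 + |t|) ^ N) :=
        mul_le_mul (h z t) (k z t) (norm_nonneg _) (by positivity)
    _ = _ := by ring

theorem RapidBound.add (hw : ∀ z, 1 ≤ w z) {φ ψ : Z → ℝ → ℂ} (hφ : RapidBound w φ)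
    (hψ : RapidBound w ψ) : RapidBound w fun z t => φ z t + ψ z t := by
  refine ⟨hφ.1.add hψ.1, fun j => ?_⟩
  obtain ⟨C, M, hC, h⟩ := hφ.2 j
  obtain ⟨D, N, hD, k⟩ := hψ.2 j
  refine ⟨C + D, M + N, by positivity, fun z t => ?_⟩
  have h1 := hw z
  calc (1 + |t|) ^ j * ‖φ z t + ψ z t‖ ≤ (1 + |t|) ^ j * (‖φ z t‖ + ‖ψ z t‖) := by
        gcongr; exact norm_add_le _ _
    _ ≤ C * w z ^ M + D * w z ^ N := by rw [mul_add]; exact add_le_add (h z t) (k z t)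
    _ ≤ C * w z ^ (M + N) + D * w z ^ (M + N) := by
        gcongr <;> first | assumption | omega
    _ = _ := by ring

theorem TemperateBound.mul_rapid {φ ψ : Z → ℝ → ℂ} (hw : ∀ z, 1 ≤ w z)
    (hφ : TemperateBound w φ) (hψ : RapidBound w ψ) :
    RapidBound w fun z t => φ z t * ψ z t := by
  refine ⟨hφ.1.mul hψ.1, fun j => ?_⟩
  obtain ⟨-, C, M, hC, h⟩ := hφ
  obtain ⟨D, N, hD, k⟩ := hψ.2 (j + M)
  refine ⟨C * D, M + N, by positivity, fun z t => ?_⟩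
  have h1 := hw z
  rw [norm_mul]
  calc (1 + |t|) ^ j * (‖φ z t‖ * ‖ψ z t‖)
      ≤ (1 + |t|) ^ j * ((C * w z ^ M * (1 + |t|) ^ M) * ‖ψ z t‖) := by
        gcongr; exact h z t
    _ = C * w z ^ M * ((1 + |t|) ^ (j + M) * ‖ψ z t‖) := by ring
    _ ≤ C * w z ^ M * (D * w z ^ N) :=
        mul_le_mul_of_nonneg_left (k z t) (by positivity)
    _ = _ := by ring

theorem TemperateFamily.add (hw : ∀ z, 1 ≤ w z) {φ ψ : Z → ℝ → ℂ} (hφ : TemperateFamily w φ)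
    (hψ : TemperateFamily w ψ) : TemperateFamily w fun z t => φ z t + ψ z t := fun n =>
  DerivTower.add (fun _ _ => TemperateBound.add hw) (hφ n) (hψ n)

theorem TemperateFamily.mul (hw : ∀ z, 1 ≤ w z) {φ ψ : Z → ℝ → ℂ} (hφ : TemperateFamily w φ)
    (hψ : TemperateFamily w ψ) : TemperateFamily w fun z t => φ z t * ψ z t := fun n =>
  DerivTower.mul (fun _ _ => TemperateBound.mul hw) (fun _ _ => TemperateBound.add hw)
    (hφ n) (hψ n)

theorem TemperateFamily.mul_schwartz (hw : ∀ z, 1 ≤ w z) {φ ψ : Z → ℝ → ℂ}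
    (hφ : TemperateFamily w φ) (hψ : SchwartzFamily w ψ) :
    SchwartzFamily w fun z t => φ z t * ψ z t := fun n =>
  DerivTower.mul (fun _ _ => TemperateBound.mul_rapid hw) (fun _ _ => RapidBound.add hw)
    (hφ n) (hψ n)

theorem TemperateFamily.const {c : Z → ℂ} (hc : Continuous c)
    (hb : ∃ (C : ℝ) (M : ℕ), 0 ≤ C ∧ ∀ z, ‖c z‖ ≤ C * w z ^ M) (hw : ∀ z, 1 ≤ w z) :
    TemperateFamily w fun z _ => c z := by
  intro n
  induction n generalizing c with
  | zero =>
    obtain ⟨C, M, hC, h⟩ := hb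
    refine ⟨by fun_prop, C, M, hC, fun z t => (h z).trans ?_⟩
    have h1 := hw z
    exact le_mul_of_one_le_right (by positivity) (one_le_pow₀ (by simp))
  | succ n ih =>
    refine ⟨(ih hc hb).base, fun _ _ => 0, fun z t => hasDerivAt_const t (c z), ?_⟩
    exact ih continuous_const ⟨0, 0, le_rfl, by simp⟩

theorem TemperateFamily.id (hw : ∀ z, 1 ≤ w z) : TemperateFamily w fun _ t => (t : ℂ) := by
  have h0 : TemperateBound w fun _ t => (t : ℂ) := by
    refine ⟨by fun_prop, 1, 1, zero_le_one, fun z t => ?_⟩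
    have h1 := hw z
    simp only [Complex.norm_real, Real.norm_eq_abs, pow_one, one_mul]
    nlinarith [abs_nonneg t]
  intro n
  cases n with
  | zero => exact h0
  | succ n =>
    exact ⟨h0, fun _ _ => 1, fun z t => Complex.ofRealCLM.hasDerivAt,
      TemperateFamily.const continuous_const ⟨1, 0, zero_le_one, by simp⟩ hw n⟩

theorem TemperateFamily.pow (hw : ∀ z, 1 ≤ w z) {φ : Z → ℝ → ℂ} (hφ : TemperateFamily w φ)
    (j : ℕ) : TemperateFamily w fun z t => φ z t ^ j := by
  induction j with
  | zero =>
    simpa using TemperateFamily.const (w := w) (c := fun _ => 1) continuous_const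
      ⟨1, 0, zero_le_one, by simp⟩ hw
  | succ j ih => simpa only [pow_succ] using ih.mul hw hφ

/-- The Schwartz functions of a Schwartz family. -/
def SchwartzFamily.toSchwartz {φ : Z → ℝ → ℂ} (h : SchwartzFamily w φ) (z : Z) : 𝓢(ℝ, ℂ) :=
  schwartzOfTower (fun n => iteratedDeriv n (φ z))
    (fun n t => (h (n + 1)).hasDerivAt_iteratedDeriv z t)
    (fun k n => by
      obtain ⟨C, M, -, hC⟩ := ((h n).iteratedDeriv).2 k
      refine ⟨C * w z ^ M, fun x => le_trans ?_ (hC z x)⟩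
      gcongr
      linarith)

@[simp]
theorem SchwartzFamily.toSchwartz_apply {φ : Z → ℝ → ℂ} (h : SchwartzFamily w φ) (z : Z)
    (t : ℝ) : h.toSchwartz z t = φ z t := by
  change iteratedDeriv 0 (φ z) t = φ z t
  simp

theorem SchwartzFamily.coe_toSchwartz {φ : Z → ℝ → ℂ} (h : SchwartzFamily w φ) (z : Z) :
    (h.toSchwartz z : ℝ → ℂ) = φ z := funext fun t => h.toSchwartz_apply z t

theorem SchwartzFamily.exists_seminorm_le {φ : Z → ℝ → ℂ} (h : SchwartzFamily w φ)
    (hw : ∀ z, 1 ≤ w z) (s : Finset (ℕ × ℕ)) : ∃ (C : ℝ) (M : ℕ), 0 ≤ C ∧ ∀ z,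
      (s.sup (schwartzSeminormFamily ℂ ℝ ℂ)) (h.toSchwartz z) ≤ C * w z ^ M := by
  classical
  induction s using Finset.induction_on with
  | empty => exact ⟨0, 0, le_rfl, by simp⟩
  | insert i s _ ih =>
    obtain ⟨C, M, hC, hb⟩ := ih
    obtain ⟨D, N, hD, hd⟩ := ((h i.2).iteratedDeriv).2 i.1
    refine ⟨C + D, M + N, by positivity, fun z => ?_⟩
    have h1 := hw z
    have h2 : schwartzSeminormFamily ℂ ℝ ℂ i (h.toSchwartz z) ≤ D * w z ^ N := by
      refine SchwartzMap.seminorm_le_bound' ℂ i.1 i.2 _ (by positivity) fun x => ?_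
      rw [h.coe_toSchwartz]
      refine le_trans ?_ (hd z x)
      gcongr
      linarith
    rw [Finset.sup_insert, Seminorm.sup_apply]
    refine max_le (h2.trans ?_) ((hb z).trans ?_)
    · gcongr <;> first | assumption | omega | linarith
    · gcongr <;> first | assumption | omega | linarith

/-- On a compact interval joint continuity gives closeness uniformly in `t`; outside it, one spare
power of `1 + |t|` in the decay bound, locally uniform in the parameter, makes the tails small.
Continuity of the atoms supplies the measurability needed for integration over `𝕐`. -/
theorem SchwartzFamily.continuous_toSchwartz {φ : Z → ℝ → ℂ} (h : SchwartzFamily w φ)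
    (hw : Continuous w) (hw1 : ∀ z, 1 ≤ w z) : Continuous h.toSchwartz := by
  rw [continuous_iff_continuousAt]
  intro z₀
  rw [ContinuousAt, (schwartz_withSeminorms ℂ ℝ ℂ).tendsto_nhds]
  rintro ⟨k, n⟩ ε hε
  obtain ⟨hcont, hb⟩ := (h n).iteratedDeriv
  obtain ⟨C, M, hC, hb⟩ := hb (k + 1)
  set ψ : Z → ℝ → ℂ := fun z => iteratedDeriv n (φ z) with hψ
  let B : ℝ := C * w z₀ ^ M + 1
  have hB : 0 < B := by have := hw1 z₀; positivity
  have hBz : ∀ᶠ z in 𝓝 z₀, C * w z ^ M < B :=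
    ((continuous_const.mul (hw.pow M)).tendsto z₀).eventually (gt_mem_nhds (lt_add_one _))
  -- For `|t| > R` the bound `2B / (1 + |t|)` on the tail is below `ε / 2`.
  let R : ℝ := 4 * B / ε
  have hcomp : ∀ᶠ z in 𝓝 z₀, ∀ t ∈ Set.Icc (-R) R, |t| ^ k * ‖ψ z t - ψ z₀ t‖ < ε / 2 := by
    refine isCompact_Icc.eventually_forall_of_forall_eventually fun t _ => ?_
    have hc : Continuous fun p : Z × ℝ => |p.2| ^ k * ‖ψ p.1 p.2 - ψ z₀ p.2‖ := by
      have : Continuous fun p : Z × ℝ => ψ z₀ p.2 :=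
        hcont.comp (continuous_const.prodMk continuous_snd)
      fun_prop
    refine (hc.tendsto (z₀, t)).eventually (gt_mem_nhds ?_)
    simpa using hε
  filter_upwards [hBz, hcomp] with z hz hzc
  refine lt_of_le_of_lt ?_ (half_lt_self hε)
  refine SchwartzMap.seminorm_le_bound' ℂ k n _ (by positivity) fun t => ?_
  rw [iteratedDeriv_sub_schwartz, h.coe_toSchwartz, h.coe_toSchwartz]
  by_cases ht : t ∈ Set.Icc (-R) R
  · exact (hzc t ht).le
  · have hR : R < |t| := by
      by_contra! hcon
      exact ht (abs_le.1 hcon)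
    have h1 : (1 + |t|) ^ k * ‖ψ z t - ψ z₀ t‖ * (1 + |t|) ≤ 2 * B := by
      calc _ ≤ (1 + |t|) ^ k * (‖ψ z t‖ + ‖ψ z₀ t‖) * (1 + |t|) := by
            gcongr; exact norm_sub_le _ _
        _ = (1 + |t|) ^ (k + 1) * ‖ψ z t‖ + (1 + |t|) ^ (k + 1) * ‖ψ z₀ t‖ := by ring
        _ ≤ C * w z ^ M + C * w z₀ ^ M := add_le_add (hb z t) (hb z₀ t)
        _ ≤ 2 * B := by simp only [B] at hz ⊢; linarith
    have h2 : 4 * B < ε * (1 + |t|) := by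
      have := (div_lt_iff₀ hε).1 hR
      nlinarith
    have h3 : (1 + |t|) ^ k * ‖ψ z t - ψ z₀ t‖ ≤ ε / 2 := by
      by_contra! hcon
      nlinarith [mul_lt_mul_of_pos_right hcon (show 0 < 1 + |t| by positivity)]
    refine le_trans ?_ h3
    gcongr
    linarith

end Families

/-! ### Taylor remainders of the exponential -/

/-- The Taylor remainder `e^{iθ} - ∑_{j < N} (iθ)^j / j!`. -/
def expRem (N : ℕ) (θ : ℝ) : ℂ :=
  Complex.exp (Complex.I * θ) - ∑ j ∈ Finset.range N, (Complex.I * θ) ^ j / (j.factorial : ℂ)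

theorem expRem_zero (θ : ℝ) : expRem 0 θ = Complex.exp (Complex.I * θ) := by simp [expRem]

theorem expRem_succ (N : ℕ) (θ : ℝ) :
    expRem (N + 1) θ = expRem N θ - (Complex.I * θ) ^ N / (N.factorial : ℂ) := by
  simp only [expRem, Finset.sum_range_succ]
  ring

theorem hasDerivAt_I_mul (θ : ℝ) : HasDerivAt (fun t : ℝ => Complex.I * (t : ℂ)) Complex.I θ := by
  simpa using (Complex.ofRealCLM.hasDerivAt (x := θ)).const_mul Complex.I

theorem hasDerivAt_expRem_zero (θ : ℝ) :
    HasDerivAt (expRem 0) (Complex.I * expRem 0 θ) θ := by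
  have : expRem 0 = fun θ : ℝ => Complex.exp (Complex.I * θ) := funext expRem_zero
  rw [this, mul_comm]
  exact (hasDerivAt_I_mul θ).cexp

theorem hasDerivAt_expRem_succ (N : ℕ) (θ : ℝ) :
    HasDerivAt (expRem (N + 1)) (Complex.I * expRem N θ) θ := by
  induction N with
  | zero =>
    have : expRem (0 + 1) = fun θ : ℝ => expRem 0 θ - 1 := funext fun θ => by
      rw [expRem_succ]; simp
    rw [this]
    exact (hasDerivAt_expRem_zero θ).sub_const 1
  | succ N ih =>
    have : expRem (N + 1 + 1) = fun θ : ℝ => expRem (N + 1) θ -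
        (Complex.I * θ) ^ (N + 1) / ((N + 1).factorial : ℂ) := funext (expRem_succ (N + 1))
    rw [this]
    have h := ih.sub (((hasDerivAt_I_mul θ).pow (N + 1)).div_const ((N + 1).factorial : ℂ))
    convert! h using 1
    rw [expRem_succ, Nat.factorial_succ]
    have h1 : ((N : ℂ) + 1) ≠ 0 := by exact_mod_cast Nat.succ_ne_zero N
    have h2 : (N.factorial : ℂ) ≠ 0 := by exact_mod_cast N.factorial_ne_zero
    push_cast
    field_simp

theorem expRem_succ_apply_zero (N : ℕ) : expRem (N + 1) 0 = 0 := by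
  induction N with
  | zero => simp [expRem]
  | succ N ih => rw [expRem_succ, ih]; simp

/-- Each remainder vanishes at `0` and has derivative `i` times the previous one, so the mean value
inequality raises the exponent by one. The sharper constant `1 / N!` is not needed. -/
theorem norm_expRem_le (N : ℕ) (θ : ℝ) : ‖expRem N θ‖ ≤ |θ| ^ N := by
  induction N generalizing θ with
  | zero => simp [expRem_zero, Complex.norm_exp]
  | succ N ih =>
    have h := (convex_Icc (-|θ|) |θ|).norm_image_sub_le_of_norm_hasDerivWithin_le
      (f := expRem (N + 1)) (f' := fun t => Complex.I * expRem N t) (C := |θ| ^ N) (x := 0) (y := θ)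
      (fun x _ => (hasDerivAt_expRem_succ N x).hasDerivWithinAt)
      (fun x hx => by
        rw [norm_mul, Complex.norm_I, one_mul]
        exact (ih x).trans (pow_le_pow_left₀ (abs_nonneg _) (abs_le.2 hx) N))
      ⟨by simp, by simp⟩ (abs_le.1 le_rfl)
    rw [expRem_succ_apply_zero, sub_zero, sub_zero, Real.norm_eq_abs] at h
    rwa [pow_succ]

theorem continuous_expRem (N : ℕ) : Continuous (expRem N) := by
  unfold expRem
  fun_prop

/-! ### The parameter space and the families attached to a window -/

/-- Parameters `(x, ξ, ε)` with `ξ ≠ 0` and `0 < ε ≤ 1`. -/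
abbrev Param : Type := {z : ℝ × ℝ × ℝ // z.2.1 ≠ 0 ∧ 0 < z.2.2 ∧ z.2.2 ≤ 1}

/-- The weight `1 + |x| + |ξ| + |ξ|⁻¹` on `𝕐`. -/
def weightY (p : ℝ × ℝ) : ℝ := 1 + |p.1| + |p.2| + |p.2|⁻¹

theorem one_le_weightY (p : ℝ × ℝ) : 1 ≤ weightY p := by
  have h1 := abs_nonneg p.1
  have h2 := abs_nonneg p.2
  have h3 := inv_nonneg.2 h2
  unfold weightY
  linarith

/-- The weight as a function on the parameter space. -/
def weight (z : Param) : ℝ := weightY (z.1.1, z.1.2.1)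

theorem one_le_weight (z : Param) : 1 ≤ weight z := one_le_weightY _

theorem continuous_weight : Continuous weight := by
  unfold weight weightY
  have : Continuous fun z : Param => |z.1.2.1|⁻¹ :=
    Continuous.inv₀ (by fun_prop) fun z => abs_ne_zero.2 z.2.1
  fun_prop

theorem abs_snd_le_weight (z : Param) : |z.1.2.1| ≤ weight z := by
  have h1 := abs_nonneg z.1.1
  have h3 := inv_nonneg.2 (abs_nonneg z.1.2.1)
  simp only [weight, weightY]
  linarith

/-- With `s = ξ(t - x)` one has `t = s/ξ + x`, so `1 + |t| ≤ weight * (1 + |s|)`; this is where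
`|ξ|⁻¹` enters the weight. Differentiation produces `ξ` times the same window built from `h'`, hence
the induction over all `h`. -/
theorem schwartzFamily_window (h : 𝓢(ℝ, ℂ)) :
    SchwartzFamily weight fun (z : Param) t => h (z.1.2.1 * (t - z.1.1)) := by
  intro n
  induction n generalizing h with
  | zero =>
    refine ⟨h.continuous.comp (by fun_prop), fun k => ?_⟩
    obtain ⟨C, hC⟩ : ∃ C : ℝ, 0 ≤ C ∧ ∀ s : ℝ, (1 + |s|) ^ k * ‖h s‖ ≤ C := by
      refine ⟨2 ^ k * (SchwartzMap.seminorm ℂ 0 0 h + SchwartzMap.seminorm ℂ k 0 h), by positivity,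
        fun s => ?_⟩
      have h0 := SchwartzMap.norm_pow_mul_le_seminorm ℂ h 0 s
      have hk := SchwartzMap.norm_pow_mul_le_seminorm ℂ h k s
      rw [Real.norm_eq_abs] at h0 hk
      have h2 : (1 + |s|) ^ k ≤ 2 ^ k * (1 + |s| ^ k) := by
        have := add_pow_le (zero_le_one) (abs_nonneg s) k
        rw [one_pow] at this
        refine this.trans ?_
        gcongr
        · norm_num
        · omega
      calc (1 + |s|) ^ k * ‖h s‖ ≤ 2 ^ k * (1 + |s| ^ k) * ‖h s‖ := by gcongr
        _ = 2 ^ k * (|s| ^ 0 * ‖h s‖ + |s| ^ k * ‖h s‖) := by ring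
        _ ≤ _ := by gcongr
    refine ⟨C, k, hC.1, fun z t => ?_⟩
    set s := z.1.2.1 * (t - z.1.1) with hs
    have ht : t = z.1.2.1⁻¹ * s + z.1.1 := by
      rw [hs, inv_mul_cancel_left₀ z.2.1]; ring
    have hw := one_le_weight z
    have h1 : 1 + |t| ≤ weight z * (1 + |s|) := by
      have h2 : |t| ≤ |z.1.2.1|⁻¹ * |s| + |z.1.1| := by
        rw [ht]
        refine (abs_add_le _ _).trans ?_
        rw [abs_mul, abs_inv]
      have h3 := abs_nonneg z.1.2.1
      have h4 := inv_nonneg.2 h3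
      have h5 := abs_nonneg z.1.1
      simp only [weight, weightY]
      nlinarith [abs_nonneg s, mul_nonneg h3 (abs_nonneg s), mul_nonneg h5 (abs_nonneg s)]
    calc (1 + |t|) ^ k * ‖h s‖ ≤ (weight z * (1 + |s|)) ^ k * ‖h s‖ := by gcongr
      _ = ((1 + |s|) ^ k * ‖h s‖) * weight z ^ k := by rw [mul_pow]; ring
      _ ≤ _ := by gcongr; exact hC.2 s
  | succ n ih =>
    refine ⟨(ih h).base, fun z t => z.1.2.1 * SchwartzMap.derivCLM ℂ ℂ h (z.1.2.1 * (t - z.1.1)),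
      fun z t => ?_, ?_⟩
    · have h1 : HasDerivAt (fun t : ℝ => z.1.2.1 * (t - z.1.1)) z.1.2.1 t := by
        simpa using ((hasDerivAt_id t).sub_const z.1.1).const_mul z.1.2.1
      have h2 := (h.differentiable (z.1.2.1 * (t - z.1.1))).hasDerivAt.scomp t h1
      rw [Complex.real_smul] at h2
      simp only [SchwartzMap.derivCLM_apply]
      exact h2
    · exact DerivTower.mul (fun _ _ => TemperateBound.mul_rapid one_le_weight)
        (fun _ _ => RapidBound.add one_le_weight)
        (TemperateFamily.const (c := fun z : Param => (z.1.2.1 : ℂ)) (by fun_prop)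
          ⟨1, 1, zero_le_one, fun z => by simpa using abs_snd_le_weight z⟩ one_le_weight n)
        (ih (SchwartzMap.derivCLM ℂ ℂ h))

/-- The phase `a t² - b ξ t`. -/
def phase (a b ξ t : ℝ) : ℝ := a * t ^ 2 - b * ξ * t

theorem temperateFamily_ofReal (a : ℝ) :
    TemperateFamily weight fun (_ : Param) _ => (a : ℂ) :=
  TemperateFamily.const continuous_const ⟨|a|, 0, abs_nonneg a, fun z => by simp⟩ one_le_weight

theorem temperateFamily_snd :
    TemperateFamily weight fun (z : Param) _ => (z.1.2.1 : ℂ) :=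
  TemperateFamily.const (by fun_prop)
    ⟨1, 1, zero_le_one, fun z => by simpa using abs_snd_le_weight z⟩ one_le_weight

theorem temperateFamily_phase (a b : ℝ) :
    TemperateFamily weight fun (z : Param) t => (phase a b z.1.2.1 t : ℂ) := by
  have hw := one_le_weight
  have h := ((temperateFamily_ofReal a).mul hw ((TemperateFamily.id hw).pow hw 2)).add hw
    (((temperateFamily_ofReal (-b)).mul hw temperateFamily_snd).mul hw (TemperateFamily.id hw))
  convert! h using 3 with z t
  simp only [phase]
  push_cast
  ring

theorem temperateFamily_I_mul_deriv_phase (a b : ℝ) :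
    TemperateFamily weight fun (z : Param) t =>
      Complex.I * ((2 * a * t - b * z.1.2.1 : ℝ) : ℂ) := by
  have hw := one_le_weight
  have h := (TemperateFamily.const (w := weight) (c := fun _ => Complex.I) continuous_const
    ⟨1, 0, zero_le_one, by simp⟩ hw).mul hw
    (((temperateFamily_ofReal (2 * a)).mul hw (TemperateFamily.id hw)).add hw
    ((temperateFamily_ofReal (-b)).mul hw temperateFamily_snd))
  convert! h using 4 with z t
  push_cast
  ring

theorem hasDerivAt_phase (a b ξ t : ℝ) : HasDerivAt (phase a b ξ) (2 * a * t - b * ξ) t := by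
  have h := ((hasDerivAt_pow 2 t).const_mul a).sub ((hasDerivAt_id t).const_mul (b * ξ))
  convert! h using 1
  simp
  ring

/-- The rescaled remainder `ε^{-2N} (e^{iε²q} - ∑_{j < N} (iε²q)^j / j!)`, `q` the phase. -/
def phaseRem (a b : ℝ) (N : ℕ) (z : Param) (t : ℝ) : ℂ :=
  (((z.1.2.2 ^ 2) ^ N)⁻¹ : ℝ) * expRem N (z.1.2.2 ^ 2 * phase a b z.1.2.1 t)

/-- The factor `ε^{-2N}` exactly compensates `|ε² q|^N`, leaving `|q|^N` and hence a bound
independent of `ε`. -/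
theorem temperateBound_phaseRem (a b : ℝ) (N : ℕ) :
    TemperateBound weight (phaseRem a b N) := by
  refine ⟨?_, ?_⟩
  · have h1 : Continuous fun p : Param × ℝ => ((p.1.1.2.2 ^ 2) ^ N)⁻¹ :=
      Continuous.inv₀ (by fun_prop) fun p => (pow_pos (pow_pos p.1.2.2.1 2) N).ne'
    have h2 : Continuous fun p : Param × ℝ => p.1.1.2.2 ^ 2 * phase a b p.1.1.2.1 p.2 := by
      unfold phase
      fun_prop
    exact (Complex.continuous_ofReal.comp h1).mul ((continuous_expRem N).comp h2)
  · obtain ⟨-, C, M, hC, h⟩ := ((temperateFamily_phase a b).pow one_le_weight N 0).base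
    refine ⟨C, M, hC, fun z t => le_trans ?_ (h z t)⟩
    have hε : 0 < (z.1.2.2 ^ 2) ^ N := pow_pos (pow_pos z.2.2.1 2) N
    rw [phaseRem, norm_mul, norm_pow, Complex.norm_real, Complex.norm_real, Real.norm_eq_abs,
      Real.norm_eq_abs, abs_of_pos (inv_pos.2 hε), inv_mul_le_iff₀ hε]
    refine (norm_expRem_le _ _).trans (le_of_eq ?_)
    rw [abs_mul, mul_pow, abs_of_nonneg (sq_nonneg z.1.2.2)]

/-- By the chain rule the derivative of the `(N+1)`-st rescaled remainder is `i q'` times the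
`N`-th: the inner factor `ε²` lowers the power of `ε^{-2}` by one. At `N = 0` that factor stays and
is bounded by `1`. -/
theorem temperateFamily_phaseRem (a b : ℝ) (N : ℕ) :
    TemperateFamily weight (phaseRem a b N) := by
  have hw := one_le_weight
  intro n
  induction n generalizing N with
  | zero => exact temperateBound_phaseRem a b N
  | succ n ih =>
    have hin : ∀ (z : Param) (t : ℝ), HasDerivAt (fun t => z.1.2.2 ^ 2 * phase a b z.1.2.1 t)
        (z.1.2.2 ^ 2 * (2 * a * t - b * z.1.2.1)) t := fun z t =>
      (hasDerivAt_phase a b z.1.2.1 t).const_mul _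
    cases N with
    | zero =>
      refine ⟨temperateBound_phaseRem a b 0, fun z t =>
        (((z.1.2.2 ^ 2 : ℝ) : ℂ) * (Complex.I * ((2 * a * t - b * z.1.2.1 : ℝ) : ℂ))) *
          phaseRem a b 0 z t, fun z t => ?_, ?_⟩
      · have h1 := ((hasDerivAt_expRem_zero (z.1.2.2 ^ 2 * phase a b z.1.2.1 t)).scomp t
          (hin z t)).const_mul ((((z.1.2.2 ^ 2) ^ 0)⁻¹ : ℝ) : ℂ)
        convert! h1 using 1
        simp only [phaseRem, Complex.real_smul]
        push_cast
        ring
      · refine DerivTower.mul (fun _ _ => TemperateBound.mul hw) (fun _ _ => TemperateBound.add hw)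
          ((TemperateFamily.mul hw (TemperateFamily.const
            (c := fun z : Param => ((z.1.2.2 ^ 2 : ℝ) : ℂ)) (by fun_prop) ?_ hw)
            (temperateFamily_I_mul_deriv_phase a b)) n) (ih 0)
        refine ⟨1, 0, zero_le_one, fun z => ?_⟩
        rw [Complex.norm_real, Real.norm_eq_abs, abs_of_nonneg (sq_nonneg _)]
        simpa using abs_le.2 ⟨by linarith [z.2.2.1], z.2.2.2⟩
    | succ N =>
      refine ⟨temperateBound_phaseRem a b (N + 1), fun z t =>
        (Complex.I * ((2 * a * t - b * z.1.2.1 : ℝ) : ℂ)) * phaseRem a b N z t, fun z t => ?_, ?_⟩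
      · have h1 := ((hasDerivAt_expRem_succ N (z.1.2.2 ^ 2 * phase a b z.1.2.1 t)).scomp t
          (hin z t)).const_mul ((((z.1.2.2 ^ 2) ^ (N + 1))⁻¹ : ℝ) : ℂ)
        convert! h1 using 1
        have hε : (z.1.2.2 : ℂ) ≠ 0 := by exact_mod_cast z.2.2.1.ne'
        simp only [phaseRem, Complex.real_smul]
        push_cast
        field_simp
        ring
      · exact DerivTower.mul (fun _ _ => TemperateBound.mul hw) (fun _ _ => TemperateBound.add hw)
          (temperateFamily_I_mul_deriv_phase a b n) (ih N)

theorem schwartzFamily_phase_pow_mul_window (a b : ℝ) (j : ℕ) (h : 𝓢(ℝ, ℂ)) :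
    SchwartzFamily weight fun (z : Param) t =>
      (phase a b z.1.2.1 t : ℂ) ^ j * h (z.1.2.1 * (t - z.1.1)) :=
  ((temperateFamily_phase a b).pow one_le_weight j).mul_schwartz one_le_weight
    (schwartzFamily_window h)

theorem schwartzFamily_phaseRem_mul_window (a b : ℝ) (N : ℕ) (h : 𝓢(ℝ, ℂ)) :
    SchwartzFamily weight fun (z : Param) t =>
      phaseRem a b N z t * h (z.1.2.1 * (t - z.1.1)) :=
  (temperateFamily_phaseRem a b N).mul_schwartz one_le_weight (schwartzFamily_window h)

/-- The Schwartz function `t ↦ q(t)^j h(ξ(t - x))`, `q` the phase. -/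
def powAtom (a b : ℝ) (j : ℕ) (h : 𝓢(ℝ, ℂ)) : Param → 𝓢(ℝ, ℂ) :=
  (schwartzFamily_phase_pow_mul_window a b j h).toSchwartz

/-- The Schwartz function `t ↦ phaseRem(t) h(ξ(t - x))`. -/
def remAtom (a b : ℝ) (N : ℕ) (h : 𝓢(ℝ, ℂ)) : Param → 𝓢(ℝ, ℂ) :=
  (schwartzFamily_phaseRem_mul_window a b N h).toSchwartz

@[simp]
theorem powAtom_apply (a b : ℝ) (j : ℕ) (h : 𝓢(ℝ, ℂ)) (z : Param) (t : ℝ) :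
    powAtom a b j h z t = (phase a b z.1.2.1 t : ℂ) ^ j * h (z.1.2.1 * (t - z.1.1)) :=
  (schwartzFamily_phase_pow_mul_window a b j h).toSchwartz_apply z t

@[simp]
theorem remAtom_apply (a b : ℝ) (N : ℕ) (h : 𝓢(ℝ, ℂ)) (z : Param) (t : ℝ) :
    remAtom a b N h z t = phaseRem a b N z t * h (z.1.2.1 * (t - z.1.1)) :=
  (schwartzFamily_phaseRem_mul_window a b N h).toSchwartz_apply z t

/-- `remAtom` of order `0` carries the full chirp `e^{iε² q}`, so this is its Taylor expansion:
terms in `𝓢₀` plus a remainder that need not lie there. -/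
theorem remAtom_zero_eq (a b : ℝ) (N : ℕ) (h : 𝓢(ℝ, ℂ)) (z : Param) :
    remAtom a b 0 h z = ∑ j ∈ Finset.range N,
        ((Complex.I * (z.1.2.2 : ℂ) ^ 2) ^ j / (j.factorial : ℂ)) • powAtom a b j h z +
      ((z.1.2.2 : ℂ) ^ 2) ^ N • remAtom a b N h z := by
  ext t
  have hε : (z.1.2.2 : ℂ) ≠ 0 := by exact_mod_cast z.2.2.1.ne'
  have hsum : (∑ j ∈ Finset.range N, ((Complex.I * (z.1.2.2 : ℂ) ^ 2) ^ j / (j.factorial : ℂ)) •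
      powAtom a b j h z) t = ∑ j ∈ Finset.range N,
      ((Complex.I * (z.1.2.2 : ℂ) ^ 2) ^ j / (j.factorial : ℂ)) * powAtom a b j h z t := by
    simp
  rw [add_apply, hsum, smul_apply, smul_eq_mul, remAtom_apply, remAtom_apply, phaseRem, phaseRem,
    expRem_zero]
  simp only [powAtom_apply]
  have h1 : ∀ j, (Complex.I * (z.1.2.2 : ℂ) ^ 2) ^ j / (j.factorial : ℂ) *
      ((phase a b z.1.2.1 t : ℂ) ^ j * h (z.1.2.1 * (t - z.1.1))) =
      (Complex.I * ((z.1.2.2 ^ 2 * phase a b z.1.2.1 t : ℝ) : ℂ)) ^ j / (j.factorial : ℂ) *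
        h (z.1.2.1 * (t - z.1.1)) := fun j => by
    push_cast
    ring
  simp only [h1]
  rw [← Finset.sum_mul, expRem]
  push_cast
  field_simp
  ring

/-! ### Stability of `𝓢₀(ℝ)` -/

theorem integral_polynomial_mul_eq_zero {φ : 𝓢(ℝ, ℂ)} (hφ : φ ∈ S0) (p : Polynomial ℂ) :
    ∫ x : ℝ, p.eval (x : ℂ) * φ x = 0 := by
  simp only [Polynomial.eval_eq_sum_range, Finset.sum_mul, mul_assoc]
  rw [integral_finsetSum _ fun k _ => (integrable_pow_mul_schwartz k φ).const_mul _]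
  refine Finset.sum_eq_zero fun k _ => ?_
  rw [integral_const_mul, hφ k, mul_zero]

theorem mem_S0_of_eq_polynomial_mul {φ ψ : 𝓢(ℝ, ℂ)} (hφ : φ ∈ S0) (p : Polynomial ℂ)
    (h : ∀ t : ℝ, ψ t = p.eval (t : ℂ) * φ t) : ψ ∈ S0 := by
  intro k
  have := integral_polynomial_mul_eq_zero hφ (Polynomial.X ^ k * p)
  rw [← this]
  congr 1
  ext t
  simp [h t, mul_assoc]

/-- A moment of a translate is the integral of `φ` against the polynomial `(t + x)^k`. -/
theorem mem_S0_of_eq_comp_sub {φ ψ : 𝓢(ℝ, ℂ)} (hφ : φ ∈ S0) (x : ℝ)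
    (h : ∀ t : ℝ, ψ t = φ (t - x)) : ψ ∈ S0 := by
  intro k
  have := integral_polynomial_mul_eq_zero hφ ((Polynomial.X + Polynomial.C (x : ℂ)) ^ k)
  have hshift := integral_sub_right_eq_self (μ := volume) (fun t : ℝ =>
    ((Polynomial.X + Polynomial.C (x : ℂ)) ^ k).eval (t : ℂ) * φ t) x
  rw [← this, ← hshift]
  congr 1
  ext t
  simp [h t]

/-- The complex conjugate of a Schwartz function. -/
def conjSchwartz (g : 𝓢(ℝ, ℂ)) : 𝓢(ℝ, ℂ) :=
  SchwartzMap.postcompCLM (𝕜 := ℝ) (Complex.conjCLE : ℂ →L[ℝ] ℂ) g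

theorem conjSchwartz_apply (g : 𝓢(ℝ, ℂ)) (t : ℝ) :
    conjSchwartz g t = (starRingEnd ℂ) (g t) := by
  simp [conjSchwartz]

theorem conjSchwartz_mem_S0 {g : 𝓢(ℝ, ℂ)} (hg : g ∈ S0) : conjSchwartz g ∈ S0 := by
  intro k
  have : ∀ x : ℝ, (x : ℂ) ^ k * conjSchwartz g x = (starRingEnd ℂ) ((x : ℂ) ^ k * g x) := by
    intro x
    simp [conjSchwartz_apply]
  simp only [this]
  rw [integral_conj, hg k, map_zero]

theorem powAtom_mem_S0 (a b : ℝ) (j : ℕ) {h : 𝓢(ℝ, ℂ)} (hh : h ∈ S0) (z : Param) :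
    powAtom a b j h z ∈ S0 := by
  have h0 : powAtom a b 0 h z ∈ S0 :=
    mem_S0_of_eq_comp_sub (dilate_mem_S0 z.1.2.1 hh) z.1.1 fun t => by
      simp [dilate_apply z.2.1]
  refine mem_S0_of_eq_polynomial_mul h0
    ((Polynomial.C (a : ℂ) * Polynomial.X ^ 2 -
      Polynomial.C ((b * z.1.2.1 : ℝ) : ℂ) * Polynomial.X) ^ j) fun t => ?_
  simp [phase]

/-! ### Dilations -/

/-- Dilation as a continuous linear operator. -/
def dilateCLM (a : ℝ) : 𝓢(ℝ, ℂ) →L[ℂ] 𝓢(ℝ, ℂ) :=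
  if h : a = 0 then 0
  else SchwartzMap.compCLMOfContinuousLinearEquiv ℂ
    (ContinuousLinearEquiv.unitsEquivAut ℝ (Units.mk0 a h))

theorem dilateCLM_apply (a : ℝ) (φ : 𝓢(ℝ, ℂ)) : dilateCLM a φ = dilate a φ := by
  by_cases h : a = 0 <;> simp [dilateCLM, dilate, h]

/-- Each derivative costs a factor `ε⁻¹`, while the polynomial weight costs nothing because `|t| ≤
|t / ε|`. -/
theorem schwartzSeminormFamily_dilate_inv_le {ε : ℝ} (hε : 0 < ε) (hε1 : ε ≤ 1)
    (i : ℕ × ℕ) (φ : 𝓢(ℝ, ℂ)) :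
    schwartzSeminormFamily ℂ ℝ ℂ i (dilate ε⁻¹ φ) ≤
      ε⁻¹ ^ i.2 * schwartzSeminormFamily ℂ ℝ ℂ i φ := by
  refine SchwartzMap.seminorm_le_bound' ℂ i.1 i.2 _ (by positivity) fun t => ?_
  have h1 : (dilate ε⁻¹ φ : ℝ → ℂ) = fun t => φ (ε⁻¹ * t) :=
    funext fun t => dilate_apply (inv_ne_zero hε.ne') φ t
  rw [h1, congrFun (iteratedDeriv_comp_const_smul (φ.smooth i.2) ε⁻¹) t, norm_smul, norm_pow,
    Real.norm_eq_abs, abs_of_pos (inv_pos.2 hε)]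
  have h2 := SchwartzMap.le_seminorm' ℂ i.1 i.2 φ (ε⁻¹ * t)
  have h3 : |t| ≤ |ε⁻¹ * t| := by
    rw [abs_mul, abs_of_pos (inv_pos.2 hε)]
    exact le_mul_of_one_le_left (abs_nonneg t) ((one_le_inv₀ hε).2 hε1)
  calc |t| ^ i.1 * (ε⁻¹ ^ i.2 * ‖iteratedDeriv i.2 φ (ε⁻¹ * t)‖)
      = ε⁻¹ ^ i.2 * (|t| ^ i.1 * ‖iteratedDeriv i.2 φ (ε⁻¹ * t)‖) := by ring
    _ ≤ ε⁻¹ ^ i.2 * (|ε⁻¹ * t| ^ i.1 * ‖iteratedDeriv i.2 φ (ε⁻¹ * t)‖) := by gcongr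
    _ ≤ _ := by gcongr; exact h2

theorem exists_sup_seminorm_dilate_inv_le (s : Finset (ℕ × ℕ)) : ∃ M : ℕ, ∀ ε : ℝ, 0 < ε → ε ≤ 1 →
    ∀ φ : 𝓢(ℝ, ℂ), (s.sup (schwartzSeminormFamily ℂ ℝ ℂ)) (dilate ε⁻¹ φ) ≤
      ε⁻¹ ^ M * (s.sup (schwartzSeminormFamily ℂ ℝ ℂ)) φ := by
  refine ⟨s.sup Prod.snd, fun ε hε hε1 φ => ?_⟩
  refine Seminorm.finset_sup_apply_le (by positivity) fun i hi => ?_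
  refine (schwartzSeminormFamily_dilate_inv_le hε hε1 i φ).trans ?_
  have h1 : 1 ≤ ε⁻¹ := (one_le_inv₀ hε).2 hε1
  have h2 : i.2 ≤ s.sup Prod.snd := Finset.le_sup (f := Prod.snd) hi
  have h3 : schwartzSeminormFamily ℂ ℝ ℂ i φ ≤ (s.sup (schwartzSeminormFamily ℂ ℝ ℂ)) φ :=
    Seminorm.le_finset_sup_apply hi
  gcongr

/-- `⟨F(ε x), φ(x)⟩ = ε⁻¹ ⟨F(x), φ(x / ε)⟩` for a tempered distribution `F`. -/
def scaledTempered (F : 𝓢'(ℝ, ℂ)) (ε : ℝ) (φ : 𝓢(ℝ, ℂ)) : ℂ :=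
  ((ε⁻¹ : ℝ) : ℂ) * F (dilateCLM ε⁻¹ φ)

theorem scaledTempered_eq_scaledPairing {F : 𝓢'(ℝ, ℂ)} {f : LizorkinDistribution}
    (hF : Represents F f) (ε : ℝ) (φ : S0) :
    scaledTempered F ε φ = scaledPairing f ε φ := by
  rw [scaledTempered, scaledPairing, dilateCLM_apply, ← hF]

theorem scaledTempered_add (F : 𝓢'(ℝ, ℂ)) (ε : ℝ) (φ ψ : 𝓢(ℝ, ℂ)) :
    scaledTempered F ε (φ + ψ) = scaledTempered F ε φ + scaledTempered F ε ψ := by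
  simp [scaledTempered, mul_add]

theorem scaledTempered_smul (F : 𝓢'(ℝ, ℂ)) (ε : ℝ) (c : ℂ) (φ : 𝓢(ℝ, ℂ)) :
    scaledTempered F ε (c • φ) = c * scaledTempered F ε φ := by
  simp [scaledTempered, mul_left_comm]

theorem scaledTempered_sum (F : 𝓢'(ℝ, ℂ)) (ε : ℝ) {ι : Type*} (s : Finset ι)
    (φ : ι → 𝓢(ℝ, ℂ)) :
    scaledTempered F ε (∑ i ∈ s, φ i) = ∑ i ∈ s, scaledTempered F ε (φ i) := by
  simp [scaledTempered, Finset.mul_sum]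

theorem exists_norm_scaledTempered_le (F : 𝓢'(ℝ, ℂ)) :
    ∃ (s : Finset (ℕ × ℕ)) (C : ℝ) (M : ℕ), 0 ≤ C ∧ ∀ ε : ℝ, 0 < ε → ε ≤ 1 → ∀ φ : 𝓢(ℝ, ℂ),
      ‖scaledTempered F ε φ‖ ≤ C * ε⁻¹ ^ M * (s.sup (schwartzSeminormFamily ℂ ℝ ℂ)) φ := by
  obtain ⟨s, C, hC, h⟩ := exists_bound_temperedDistribution F
  obtain ⟨M, hM⟩ := exists_sup_seminorm_dilate_inv_le s
  refine ⟨s, C, M + 1, hC, fun ε hε hε1 φ => ?_⟩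
  rw [scaledTempered, norm_mul, Complex.norm_real, Real.norm_eq_abs, abs_of_pos (inv_pos.2 hε),
    dilateCLM_apply]
  have h0 := inv_pos.2 hε
  calc _ ≤ ε⁻¹ * (C * (ε⁻¹ ^ M * (s.sup (schwartzSeminormFamily ℂ ℝ ℂ)) φ)) := by
        gcongr
        exact (h _).trans (mul_le_mul_of_nonneg_left (hM ε hε hε1 φ) hC)
    _ = _ := by ring

/-- `φ ↦ ⟨f(ε x), φ(x)⟩` as an element of `𝓢₀'(ℝ)`. -/
def scaledPairingCLM (f : LizorkinDistribution) (ε : ℝ) : LizorkinDistribution :=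
  ((ε⁻¹ : ℝ) : ℂ) • f.comp (((dilateCLM ε⁻¹).comp S0.subtypeL).codRestrict S0 fun φ => by
    simpa [dilateCLM_apply] using dilate_mem_S0 ε⁻¹ φ.2)

theorem scaledPairingCLM_apply (f : LizorkinDistribution) (ε : ℝ) (φ : S0) :
    scaledPairingCLM f ε φ = scaledPairing f ε φ := by
  simp only [scaledPairingCLM, scaledPairing, smul_apply, smul_eq_mul,
    ContinuousLinearMap.comp_apply]
  congr 2
  exact Subtype.ext (dilateCLM_apply _ _)

/-! ### Homogeneity of quasiasymptotic limits -/

/-- Homogeneity of degree `m`: `⟨f(ε x), φ(x / a)⟩ = a ⟨f(aε x), φ(x)⟩`, and `(aε)^m L(aε)` is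
asymptotic to `a^m ε^m L(ε)`; uniqueness of limits concludes. -/
theorem QuasiasymptoticAtZero.map_dilate {f u : LizorkinDistribution} {m : ℝ} {L : ℝ → ℝ}
    (h : QuasiasymptoticAtZero f m L u) (hL : SlowlyVaryingAtZero L) {a : ℝ} (ha : 0 < a)
    (φ : S0) :
    u ⟨dilate a⁻¹ φ, dilate_mem_S0 a⁻¹ φ.2⟩ = ((a ^ (m + 1) : ℝ) : ℂ) * u φ := by
  have ha' : a⁻¹ ≠ 0 := inv_ne_zero ha.ne'
  have hscale : Tendsto (fun ε : ℝ => a * ε) (𝓝[>] 0) (𝓝[>] 0) := by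
    refine tendsto_nhdsWithin_iff.2 ⟨?_, ?_⟩
    · have : Tendsto (fun ε : ℝ => a * ε) (𝓝 0) (𝓝 (a * 0)) :=
        (continuous_const.mul continuous_id).tendsto 0
      rw [mul_zero] at this
      exact this.mono_left nhdsWithin_le_nhds
    · filter_upwards [self_mem_nhdsWithin] with ε hε
      exact mul_pos ha hε
  have h1 := (h φ).comp hscale
  have h2 : Tendsto (fun ε : ℝ => ((L (a * ε) / L ε * a ^ (m + 1) : ℝ) : ℂ)) (𝓝[>] 0)
      (𝓝 ((1 * a ^ (m + 1) : ℝ) : ℂ)) :=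
    (Complex.continuous_ofReal.tendsto _).comp ((hL.2 a ha).mul_const _)
  have h3 := h2.mul h1
  rw [one_mul] at h3
  refine tendsto_nhds_unique (h ⟨dilate a⁻¹ φ, dilate_mem_S0 a⁻¹ φ.2⟩) (h3.congr' ?_)
  filter_upwards [self_mem_nhdsWithin, hL.eventually_pos, hscale.eventually hL.eventually_pos]
    with ε hε hLε hLaε
  have hε0 : 0 < ε := hε
  have hcomp : (⟨dilate ε⁻¹ (dilate a⁻¹ φ : 𝓢(ℝ, ℂ)),
      dilate_mem_S0 ε⁻¹ (dilate_mem_S0 a⁻¹ φ.2)⟩ : S0) =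
      ⟨dilate (a * ε)⁻¹ φ, dilate_mem_S0 (a * ε)⁻¹ φ.2⟩ := by
    refine Subtype.ext (SchwartzMap.ext fun t => ?_)
    have hε' : ε⁻¹ ≠ 0 := inv_ne_zero hε0.ne'
    simp only [dilate_apply hε', dilate_apply ha',
      dilate_apply (inv_ne_zero (mul_pos ha hε0).ne')]
    rw [mul_inv, mul_assoc]
  simp only [Function.comp, scaledPairing]
  rw [hcomp]
  rw [Real.mul_rpow ha.le hε0.le, Real.rpow_add_one ha.ne']
  have e1 : (a : ℂ) ≠ 0 := by exact_mod_cast ha.ne'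
  have e2 : (ε : ℂ) ≠ 0 := by exact_mod_cast hε0.ne'
  have e3 : (L ε : ℂ) ≠ 0 := by exact_mod_cast hLε.ne'
  have e4 : (L (a * ε) : ℂ) ≠ 0 := by exact_mod_cast hLaε.ne'
  have e5 : ((a ^ m : ℝ) : ℂ) ≠ 0 := by exact_mod_cast (Real.rpow_pos_of_pos ha m).ne'
  have e6 : ((ε ^ m : ℝ) : ℂ) ≠ 0 := by exact_mod_cast (Real.rpow_pos_of_pos hε0 m).ne'
  simp only [Complex.ofReal_mul, Complex.ofReal_div, Complex.ofReal_inv]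
  field_simp

/-! ### The transforms in terms of the atoms -/

/-- The substitution `t = ε s`. One factor `ε` comes from `|εξ|` and the other from the
normalization `ε⁻¹` of the scaled pairing. -/
theorem frst_eq_scaledTempered (α : ℝ) (g : 𝓢(ℝ, ℂ)) (F : 𝓢'(ℝ, ℂ)) (z : Param) :
    Complex.exp (-Complex.I * c₁ α * ((z.1.2.2 * z.1.2.1 : ℝ) : ℂ) ^ 2 / 2) *
        frst α (dilate (1 / z.1.2.2 ^ 2) g) F (z.1.2.2 * z.1.1) (z.1.2.2 * z.1.2.1) =
      Cα α * ((z.1.2.2 ^ 2 * |z.1.2.1| : ℝ) : ℂ) *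
        scaledTempered F z.1.2.2 (remAtom (c₁ α / 2) (c₂ α) 0 (conjSchwartz g) z) := by
  obtain ⟨⟨x, ξ, ε⟩, hξ, hε, hε1⟩ := z
  dsimp only at hξ hε hε1 ⊢
  set A := remAtom (c₁ α / 2) (c₂ α) 0 (conjSchwartz g) ⟨(x, ξ, ε), hξ, hε, hε1⟩ with hA
  have hεξ : ε * ξ ≠ 0 := mul_ne_zero hε.ne' hξ
  have hatom : frstAtom α (dilate (1 / ε ^ 2) g) (ε * x) (ε * ξ) =
      (Cα α * Complex.exp (Complex.I * c₁ α * ((ε * ξ : ℝ) : ℂ) ^ 2 / 2)) • dilate ε⁻¹ A := by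
    ext t
    rw [frstAtom_apply α _ _ hεξ, dilate_apply (by positivity), smul_apply, smul_eq_mul,
      dilate_apply (inv_ne_zero hε.ne'), hA, remAtom_apply, conjSchwartz_apply, phaseRem,
      expRem_zero, fracKernel]
    dsimp only
    have e1 : 1 / ε ^ 2 * (ε * ξ * (t - ε * x)) = ξ * (ε⁻¹ * t - x) := by
      field_simp
    have e2 : Complex.exp (Complex.I *
        (((t ^ 2 + (ε * ξ) ^ 2) / 2 * c₁ α - t * (ε * ξ) * c₂ α : ℝ) : ℂ)) =
        Complex.exp (Complex.I * c₁ α * ((ε * ξ : ℝ) : ℂ) ^ 2 / 2) *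
        Complex.exp (Complex.I * ((ε ^ 2 * phase (c₁ α / 2) (c₂ α) ξ (ε⁻¹ * t) : ℝ) : ℂ)) := by
      rw [← Complex.exp_add]
      congr 1
      have : ε ^ 2 * phase (c₁ α / 2) (c₂ α) ξ (ε⁻¹ * t) =
          t ^ 2 / 2 * c₁ α - t * (ε * ξ) * c₂ α := by
        unfold phase
        field_simp
      rw [this]
      push_cast
      ring
    rw [e1, e2]
    push_cast
    ring
  rw [frst, hatom, map_smul, smul_eq_mul, scaledTempered, dilateCLM_apply, abs_mul,
    abs_of_pos hε]
  have hexp : Complex.exp (-Complex.I * c₁ α * ((ε * ξ : ℝ) : ℂ) ^ 2 / 2) *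
      Complex.exp (Complex.I * c₁ α * ((ε * ξ : ℝ) : ℂ) ^ 2 / 2) = 1 := by
    rw [← Complex.exp_add]
    ring_nf
    exact Complex.exp_zero
  have hε0 : (ε : ℂ) ≠ 0 := by exact_mod_cast hε.ne'
  rw [show ∀ A B C D E : ℂ, A * (B * (C * D * E)) = (A * D) * (B * C * E) by intros; ring, hexp]
  push_cast
  field_simp

/-- The modulation cancels `e^{-iξt/c}`, leaving the window dilated by `c⁻¹`; homogeneity then gives
`c^{m+1}`, and `|ξ / c|` removes one power. The phase parameters `a`, `b` are arbitrary, since the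
phase is raised to the power `0`. -/
theorem stockwell_modulateDist_eq {f u : LizorkinDistribution} {m : ℝ} {L : ℝ → ℝ}
    (h : QuasiasymptoticAtZero f m L u) (hL : SlowlyVaryingAtZero L) {U : 𝓢'(ℝ, ℂ)}
    (hU : Represents U u) {g : 𝓢(ℝ, ℂ)} (hg : g ∈ S0) {c : ℝ} (hc : 0 < c) (a b : ℝ) (z : Param) :
    stockwell g (modulateDist (z.1.2.1 / c) U) (z.1.1 * c) (z.1.2.1 / c) =
      ((1 / Real.sqrt (2 * Real.pi) : ℝ) : ℂ) * ((c ^ m : ℝ) : ℂ) * ((|z.1.2.1| : ℝ) : ℂ) *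
        u ⟨powAtom a b 0 (conjSchwartz g) z, powAtom_mem_S0 a b 0 (conjSchwartz_mem_S0 hg) z⟩ := by
  obtain ⟨⟨x, ξ, ε⟩, hz⟩ := z
  have hξ : ξ ≠ 0 := hz.1
  dsimp only
  set A := powAtom a b 0 (conjSchwartz g) ⟨(x, ξ, ε), hz⟩ with hA
  have hAm : A ∈ S0 := powAtom_mem_S0 a b 0 (conjSchwartz_mem_S0 hg) _
  have hξc : ξ / c ≠ 0 := div_ne_zero hξ hc.ne'
  have hatom : modulate (ξ / c) (stAtom g (x * c) (ξ / c)) =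
      ((1 / Real.sqrt (2 * Real.pi) : ℝ) : ℂ) • dilate c⁻¹ A := by
    ext t
    rw [modulate_apply, stAtom_apply g _ hξc, smul_apply, smul_eq_mul,
      dilate_apply (inv_ne_zero hc.ne'), hA, powAtom_apply, conjSchwartz_apply, fourierKernel]
    dsimp only
    have e1 : ξ / c * (t - x * c) = ξ * (c⁻¹ * t - x) := by field_simp
    have e2 : Complex.exp (Complex.I * (((ξ / c : ℝ) : ℂ) * t)) *
        Complex.exp (-Complex.I * (((ξ / c : ℝ) : ℂ) * t)) = 1 := by
      rw [← Complex.exp_add]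
      ring_nf
      exact Complex.exp_zero
    rw [e1, pow_zero, one_mul]
    linear_combination ((starRingEnd ℂ) (g (ξ * (c⁻¹ * t - x))) *
      ((1 / Real.sqrt (2 * Real.pi) : ℝ) : ℂ)) * e2
  rw [stockwell, modulateDist_apply, hatom, map_smul, smul_eq_mul]
  have h1 := hU ⟨dilate c⁻¹ A, dilate_mem_S0 c⁻¹ hAm⟩
  have h2 := h.map_dilate hL hc ⟨A, hAm⟩
  dsimp only at h1 h2
  rw [h1, h2, abs_div, abs_of_pos hc, Real.rpow_add_one hc.ne']
  have hc0 : (c : ℂ) ≠ 0 := by exact_mod_cast hc.ne'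
  simp only [Complex.ofReal_mul, Complex.ofReal_div]
  field_simp
  rfl

/-- The principal root splits because one factor is a positive real; the other has real part `1`, so
it is nonzero. -/
theorem Cα_eq (α : ℝ) : Cα α =
    (1 - Complex.I * c₁ α) ^ (1 / 2 : ℂ) * ((1 / Real.sqrt (2 * Real.pi) : ℝ) : ℂ) := by
  have hpi : 0 < 2 * Real.pi := by positivity
  have hne : 1 - Complex.I * (c₁ α : ℂ) ≠ 0 := fun h => by
    have := congrArg Complex.re h
    simp at this
  have hr : 0 < (2 * Real.pi)⁻¹ := inv_pos.2 hpi
  have h1 : (1 - Complex.I * c₁ α) / (2 * Real.pi) =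
      (1 - Complex.I * c₁ α) * (((2 * Real.pi)⁻¹ : ℝ) : ℂ) := by
    push_cast
    ring
  have h2 : ((1 / Real.sqrt (2 * Real.pi) : ℝ) : ℂ) =
      (((2 * Real.pi)⁻¹ : ℝ) : ℂ) ^ (1 / 2 : ℂ) := by
    rw [one_div, ← Real.sqrt_inv, Real.sqrt_eq_rpow, Complex.ofReal_cpow hr.le]
    norm_num
  have hr0 : (((2 * Real.pi)⁻¹ : ℝ) : ℂ) ≠ 0 := by exact_mod_cast hr.ne'
  rw [Cα, h1, h2, Complex.cpow_def_of_ne_zero (mul_ne_zero hne hr0),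
    Complex.cpow_def_of_ne_zero hne, Complex.cpow_def_of_ne_zero hr0, ← Complex.exp_add,
    Complex.log_mul_ofReal _ hr _ hne, Complex.ofReal_log hr.le]
  congr 1
  ring

/-! ### Functions of polynomial growth on `𝕐` -/

theorem isOpen_Y : IsOpen Y := isOpen_ne_fun continuous_snd continuous_const

theorem weightY_pow_le (K : ℕ) (p : ℝ × ℝ) :
    weightY p ^ K ≤ 4 ^ K * (1 + |p.1| ^ K + |p.2| ^ K + |p.2|⁻¹ ^ K) := by
  have h1 := abs_nonneg p.1
  have h2 := abs_nonneg p.2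
  have h3 := inv_nonneg.2 h2
  have key : ∀ a b c d : ℝ, 0 ≤ a → 0 ≤ b → 0 ≤ c → 0 ≤ d →
      (a + b + c + d) ^ K ≤ 4 ^ K * (a ^ K + b ^ K + c ^ K + d ^ K) := by
    intro a b c d ha hb hc hd
    -- The witness `e` is the largest of the four numbers.
    have hm : ∃ e, 0 ≤ e ∧ a + b + c + d ≤ 4 * e ∧ e ^ K ≤ a ^ K + b ^ K + c ^ K + d ^ K := by
      have := pow_nonneg ha K
      have := pow_nonneg hb K
      have := pow_nonneg hc K
      have := pow_nonneg hd K
      rcases le_total a b with h | h <;> rcases le_total c d with h' | h'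
      · rcases le_total b d with h'' | h''
        · exact ⟨d, hd, by linarith, by linarith⟩
        · exact ⟨b, hb, by linarith, by linarith⟩
      · rcases le_total b c with h'' | h''
        · exact ⟨c, hc, by linarith, by linarith⟩
        · exact ⟨b, hb, by linarith, by linarith⟩
      · rcases le_total a d with h'' | h''
        · exact ⟨d, hd, by linarith, by linarith⟩
        · exact ⟨a, ha, by linarith, by linarith⟩
      · rcases le_total a c with h'' | h''
        · exact ⟨c, hc, by linarith, by linarith⟩
        · exact ⟨a, ha, by linarith, by linarith⟩
    obtain ⟨e, he, h4, hp⟩ := hm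
    calc (a + b + c + d) ^ K ≤ (4 * e) ^ K := by gcongr
      _ = 4 ^ K * e ^ K := mul_pow _ _ _
      _ ≤ _ := by gcongr
  simpa [weightY] using key 1 |p.1| |p.2| |p.2|⁻¹ zero_le_one h1 h2 h3

theorem IsSchwartzY.le_toReal_rhoY {Φ : ℝ × ℝ → ℂ} (h : IsSchwartzY Φ) (s r : ℕ) {p : ℝ × ℝ}
    (hp : p ∈ Y) :
    (|p.2| ^ s + 1 / |p.2| ^ s) * (|p.1| ^ r * ‖Φ p‖) ≤ (rhoY (s, r, 0, 0) Φ).toReal := by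
  rw [← ENNReal.ofReal_le_iff_le_toReal (h.decay _).ne]
  refine le_trans (le_of_eq ?_) (le_iSup₂ (f := fun (p : ℝ × ℝ) (_ : p ∈ Y) => ENNReal.ofReal
    ((|p.2| ^ s + 1 / |p.2| ^ s) * ‖((p.1 : ℂ) ^ r) * partialDeriv 0 0 Φ p‖)) p hp)
  simp [partialDeriv]

/-- Three seminorms without derivatives suffice: they control `1`, `|x|^K`, and `|ξ|^K` together
with `|ξ|^{-K}`. The index set does not depend on `Φ`, which is what continuity on `𝓢(𝕐)` requires.
-/
theorem exists_weightY_pow_mul_le (K : ℕ) : ∃ I : Finset (ℕ × ℕ × ℕ × ℕ), ∀ Φ, IsSchwartzY Φ →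
    ∀ p ∈ Y, weightY p ^ K * ‖Φ p‖ ≤ 3 * 4 ^ K * (∑ i ∈ I, rhoY i Φ).toReal := by
  classical
  refine ⟨{(0, 0, 0, 0), (0, K, 0, 0), (K, 0, 0, 0)}, fun Φ hΦ p hp => ?_⟩
  set S := (∑ i ∈ ({(0, 0, 0, 0), (0, K, 0, 0), (K, 0, 0, 0)} : Finset (ℕ × ℕ × ℕ × ℕ)),
    rhoY i Φ) with hS
  have hST : S ≠ ⊤ := ENNReal.sum_ne_top.2 fun i _ => (hΦ.decay i).ne
  have hle : ∀ i ∈ ({(0, 0, 0, 0), (0, K, 0, 0), (K, 0, 0, 0)} : Finset (ℕ × ℕ × ℕ × ℕ)),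
      (rhoY i Φ).toReal ≤ S.toReal := fun i hi =>
    ENNReal.toReal_mono hST (Finset.single_le_sum (f := fun i => rhoY i Φ)
      (fun _ _ => zero_le) hi)
  have h1 := (hΦ.le_toReal_rhoY 0 0 hp).trans (hle _ (by simp))
  have h2 := (hΦ.le_toReal_rhoY 0 K hp).trans (hle _ (by simp))
  have h3 := (hΦ.le_toReal_rhoY K 0 hp).trans (hle _ (by simp))
  simp only [pow_zero, div_one, one_mul] at h1 h2 h3
  have h4 : 0 ≤ |p.1| ^ K * ‖Φ p‖ := by positivity
  have h5 := norm_nonneg (Φ p)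
  rw [one_div, ← inv_pow] at h3
  calc weightY p ^ K * ‖Φ p‖
      ≤ 4 ^ K * (1 + |p.1| ^ K + |p.2| ^ K + |p.2|⁻¹ ^ K) * ‖Φ p‖ := by
        gcongr; exact weightY_pow_le K p
    _ = 4 ^ K * (‖Φ p‖ + |p.1| ^ K * ‖Φ p‖ + (|p.2| ^ K + |p.2|⁻¹ ^ K) * ‖Φ p‖) := by ring
    _ ≤ 4 ^ K * (S.toReal + S.toReal + S.toReal) := by
        gcongr
        · linarith
        · linarith
    _ = _ := by ring

theorem integrable_one_add_norm_neg_three :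
    Integrable fun p : ℝ × ℝ => (1 + ‖p‖) ^ (-3 : ℝ) :=
  integrable_one_add_norm (by norm_num)

theorem one_add_norm_le_weightY (p : ℝ × ℝ) : 1 + ‖p‖ ≤ weightY p := by
  have h1 := abs_nonneg p.1
  have h2 := abs_nonneg p.2
  have h3 := inv_nonneg.2 h2
  have h4 : ‖p‖ ≤ |p.1| + |p.2| := by
    rw [Prod.norm_def]
    exact max_le (by simp) (by simp)
  unfold weightY
  linarith

/-- Three spare powers of the weight buy the factor `(1 + ‖p‖)⁻³`, integrable because `3` exceeds
the dimension `2`. -/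
theorem weightY_pow_le_mul_rpow (M : ℕ) (p : ℝ × ℝ) :
    weightY p ^ M ≤ weightY p ^ (M + 3) * (1 + ‖p‖) ^ (-3 : ℝ) := by
  have h0 := one_le_weightY p
  have h1 : 0 < 1 + ‖p‖ := by positivity
  have h2 : (1 + ‖p‖) ^ (-3 : ℝ) = ((1 + ‖p‖) ^ 3)⁻¹ := by
    rw [Real.rpow_neg h1.le]
    norm_cast
  rw [h2, pow_add, mul_assoc]
  refine le_mul_of_one_le_right (by positivity) ?_
  rw [← div_eq_mul_inv, one_le_div (by positivity)]
  exact pow_le_pow_left₀ h1.le (one_add_norm_le_weightY p) 3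

/-- Polynomially bounded functions are dominated, uniformly, after pairing with `Φ ∈ 𝓢(𝕐)`. -/
theorem exists_norm_mul_le (M : ℕ) : ∃ I : Finset (ℕ × ℕ × ℕ × ℕ), ∀ Φ, IsSchwartzY Φ →
    ∀ p ∈ Y, ∀ (C : ℝ) (c : ℂ), 0 ≤ C → ‖c‖ ≤ C * weightY p ^ M →
      ‖c * Φ p‖ ≤ C * (3 * 4 ^ (M + 3) * (∑ i ∈ I, rhoY i Φ).toReal) *
        (1 + ‖p‖) ^ (-3 : ℝ) := by
  obtain ⟨I, hI⟩ := exists_weightY_pow_mul_le (M + 3)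
  refine ⟨I, fun Φ hΦ p hp C c hC hc => ?_⟩
  have h0 := one_le_weightY p
  rw [norm_mul]
  calc ‖c‖ * ‖Φ p‖ ≤ C * (weightY p ^ (M + 3) * (1 + ‖p‖) ^ (-3 : ℝ)) * ‖Φ p‖ := by
        gcongr
        exact hc.trans (mul_le_mul_of_nonneg_left (weightY_pow_le_mul_rpow M p) hC)
    _ = C * (weightY p ^ (M + 3) * ‖Φ p‖) * (1 + ‖p‖) ^ (-3 : ℝ) := by ring
    _ ≤ _ := mul_le_mul_of_nonneg_right (mul_le_mul_of_nonneg_left (hI Φ hΦ p hp) hC)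
        (by positivity)

theorem IsSchwartzY.aestronglyMeasurable_mul {G Φ : ℝ × ℝ → ℂ} (hΦ : IsSchwartzY Φ)
    (hG : ContinuousOn G Y) :
    AEStronglyMeasurable (fun p => G p * Φ p) (volume.restrict Y) :=
  (hG.mul hΦ.smooth.continuousOn).aestronglyMeasurable isOpen_Y.measurableSet

theorem isDistributionY_of_polynomial_growth {G : ℝ × ℝ → ℂ} (hG : ContinuousOn G Y) (C : ℝ)
    (M : ℕ) (hC : 0 ≤ C) (hb : ∀ p ∈ Y, ‖G p‖ ≤ C * weightY p ^ M) : IsDistributionY G := by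
  obtain ⟨I, hI⟩ := exists_norm_mul_le M
  have hdom : ∀ Φ, IsSchwartzY Φ → ∀ᵐ p ∂volume.restrict Y, ‖G p * Φ p‖ ≤
      C * (3 * 4 ^ (M + 3) * (∑ i ∈ I, rhoY i Φ).toReal) * (1 + ‖p‖) ^ (-3 : ℝ) := fun Φ hΦ =>
    (ae_restrict_mem isOpen_Y.measurableSet).mono fun p hp => hI Φ hΦ p hp C _ hC (hb p hp)
  have hint : ∀ c : ℝ, IntegrableOn (fun p : ℝ × ℝ => c * (1 + ‖p‖) ^ (-3 : ℝ)) Y := fun c =>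
    (integrable_one_add_norm_neg_three.const_mul c).integrableOn
  refine ⟨fun Φ hΦ => (hint _).mono' (hΦ.aestronglyMeasurable_mul hG) (hdom Φ hΦ), I,
    (C * (3 * 4 ^ (M + 3)) * ∫ p in Y, (1 + ‖p‖) ^ (-3 : ℝ)).toNNReal, fun Φ hΦ => ?_⟩
  have h1 := norm_integral_le_of_norm_le (hint _) (hdom Φ hΦ)
  rw [integral_const_mul] at h1
  have hS : (∑ i ∈ I, rhoY i Φ) ≠ ⊤ := ENNReal.sum_ne_top.2 fun i _ => (hΦ.decay i).ne
  rw [← ofReal_norm, pairingY]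
  refine (ENNReal.ofReal_le_ofReal h1).trans (le_of_eq ?_)
  rw [show C * (3 * 4 ^ (M + 3) * (∑ i ∈ I, rhoY i Φ).toReal) *
    (∫ p in Y, (1 + ‖p‖) ^ (-3 : ℝ)) = (C * (3 * 4 ^ (M + 3)) *
    ∫ p in Y, (1 + ‖p‖) ^ (-3 : ℝ)) * (∑ i ∈ I, rhoY i Φ).toReal by ring]
  rw [ENNReal.ofReal_mul' ENNReal.toReal_nonneg, ENNReal.ofReal_toReal hS]
  rfl

/-- Dominated convergence for pairings with elements of `𝓢(𝕐)`. -/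
theorem tendsto_pairingY {G : ℕ → ℝ × ℝ → ℂ} {G₀ Φ : ℝ × ℝ → ℂ} (hΦ : IsSchwartzY Φ)
    (hG : ∀ᶠ n in atTop, ContinuousOn (G n) Y) (C : ℝ) (M : ℕ) (hC : 0 ≤ C)
    (hb : ∀ᶠ n in atTop, ∀ p ∈ Y, ‖G n p‖ ≤ C * weightY p ^ M)
    (hlim : ∀ p ∈ Y, Tendsto (fun n => G n p) atTop (𝓝 (G₀ p))) :
    Tendsto (fun n => pairingY (G n) Φ) atTop (𝓝 (pairingY G₀ Φ)) := by
  obtain ⟨I, hI⟩ := exists_norm_mul_le M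
  refine tendsto_integral_filter_of_dominated_convergence
    (fun p => C * (3 * 4 ^ (M + 3) * (∑ i ∈ I, rhoY i Φ).toReal) * (1 + ‖p‖) ^ (-3 : ℝ))
    (hG.mono fun n hn => hΦ.aestronglyMeasurable_mul hn) ?_
    (integrable_one_add_norm_neg_three.const_mul _).integrableOn ?_
  · filter_upwards [hb] with n hn
    exact (ae_restrict_mem isOpen_Y.measurableSet).mono fun p hp =>
      hI Φ hΦ p hp C _ hC (hn p hp)
  · exact (ae_restrict_mem isOpen_Y.measurableSet).mono fun p hp =>
      (hlim p hp).mul_const _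

/-! ### The asymptotics of the fractional Stockwell transform -/

/-- The parameter `(x, ξ, ε)` of a point `(x, ξ)` of `𝕐`. -/
def toParam (ε : ℝ) (hε : 0 < ε) (hε1 : ε ≤ 1) (p : ℝ × ℝ) (hp : p ∈ Y) : Param :=
  ⟨(p.1, p.2, ε), hp, hε, hε1⟩

theorem continuous_toParam (ε : ℝ) (hε : 0 < ε) (hε1 : ε ≤ 1) :
    Continuous fun p : Y => toParam ε hε hε1 p p.2 :=
  Continuous.subtype_mk (by fun_prop) _

theorem continuous_remAtom (a b : ℝ) (N : ℕ) (h : 𝓢(ℝ, ℂ)) : Continuous (remAtom a b N h) :=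
  (schwartzFamily_phaseRem_mul_window a b N h).continuous_toSchwartz continuous_weight
    one_le_weight

theorem continuous_powAtom (a b : ℝ) (j : ℕ) (h : 𝓢(ℝ, ℂ)) : Continuous (powAtom a b j h) :=
  (schwartzFamily_phase_pow_mul_window a b j h).continuous_toSchwartz continuous_weight
    one_le_weight

theorem continuous_scaledTempered (F : 𝓢'(ℝ, ℂ)) (ε : ℝ) : Continuous (scaledTempered F ε) :=
  continuous_const.mul ((map_continuous F).comp (dilateCLM ε⁻¹).continuous)

/-- A function on `𝕐` that is `|ξ|` times a tempered distribution evaluated along a continuous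
family of Schwartz functions with polynomial bounds defines an element of `𝓢'(𝕐)`. -/
theorem isDistributionY_of_eq {G : ℝ × ℝ → ℂ} {ε : ℝ} (hε : 0 < ε) (hε1 : ε ≤ 1) (c : ℂ)
    {V : Param → ℂ} (hV : Continuous V) {C : ℝ} {M : ℕ} (hC : 0 ≤ C)
    (hb : ∀ z : Param, z.1.2.2 = ε → ‖V z‖ ≤ C * weight z ^ M)
    (h : ∀ p (hp : p ∈ Y), G p = c * ((|p.2| : ℝ) : ℂ) * V (toParam ε hε hε1 p hp)) :
    ContinuousOn G Y ∧ IsDistributionY G := by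
  have hcont : ContinuousOn G Y := by
    rw [continuousOn_iff_continuous_domRestrict]
    have : Y.domRestrict G = fun p : Y => c * ((|p.1.2| : ℝ) : ℂ) * V (toParam ε hε hε1 p p.2) :=
      funext fun p => h p p.2
    rw [this]
    exact (by fun_prop : Continuous fun p : Y => c * ((|p.1.2| : ℝ) : ℂ)).mul
      (hV.comp (continuous_toParam ε hε hε1))
  refine ⟨hcont, isDistributionY_of_polynomial_growth hcont (‖c‖ * C) (M + 1) (by positivity)
    fun p hp => ?_⟩
  rw [h p hp, norm_mul, norm_mul, Complex.norm_real, Real.norm_eq_abs, abs_abs]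
  have h1 := hb (toParam ε hε hε1 p hp) rfl
  have h2 := abs_snd_le_weight (toParam ε hε hε1 p hp)
  have h0 := one_le_weightY p
  change ‖_‖ ≤ C * weightY p ^ M at h1
  change |p.2| ≤ weightY p at h2
  calc ‖c‖ * |p.2| * ‖V (toParam ε hε hε1 p hp)‖
      ≤ ‖c‖ * weightY p * (C * weightY p ^ M) := by gcongr
    _ = _ := by ring

theorem exists_norm_sum_le {X : Type*} {v : X → ℝ} (hv : ∀ x, 1 ≤ v x) {φ : ℕ → X → ℂ}
    (h : ∀ j, ∃ (C : ℝ) (M : ℕ), 0 ≤ C ∧ ∀ x, ‖φ j x‖ ≤ C * v x ^ M) (N : ℕ) :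
    ∃ (C : ℝ) (M : ℕ), 0 ≤ C ∧ ∀ x, ‖∑ j ∈ Finset.range N, φ j x‖ ≤ C * v x ^ M := by
  induction N with
  | zero => exact ⟨0, 0, le_rfl, by simp⟩
  | succ N ih =>
    obtain ⟨C, M, hC, hb⟩ := ih
    obtain ⟨D, K, hD, hd⟩ := h N
    refine ⟨C + D, M + K, by positivity, fun x => ?_⟩
    have h1 := hv x
    rw [Finset.sum_range_succ, add_mul]
    refine (norm_add_le _ _).trans (add_le_add ((hb x).trans ?_) ((hd x).trans ?_))
    · gcongr
      omega
    · gcongr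
      omega

theorem exists_remainder_bound (F : 𝓢'(ℝ, ℂ)) (h : 𝓢(ℝ, ℂ)) (a b m : ℝ) {L : ℝ → ℝ}
    (hL : SlowlyVaryingAtZero L) :
    ∃ (N : ℕ) (δ C : ℝ) (M : ℕ), 0 < N ∧ 0 < δ ∧ 0 ≤ C ∧ ∀ z : Param, z.1.2.2 ≤ δ →
      0 < L z.1.2.2 ∧
      ‖((z.1.2.2 : ℂ) ^ 2) ^ N * scaledTempered F z.1.2.2 (remAtom a b N h z) /
        ((z.1.2.2 ^ m * L z.1.2.2 : ℝ) : ℂ)‖ ≤ C * z.1.2.2 * weight z ^ M := by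
  obtain ⟨s, D, K, hD, hF⟩ := exists_norm_scaledTempered_le F
  obtain ⟨δ, c, hδ, hc, hLc⟩ := hL.exists_sq_le
  obtain ⟨m', hm'⟩ := exists_nat_ge m
  -- `K` pays for the dilation loss of `F`, `m'` for `ε^m`, `2` for `L ε ≥ c ε²`, and the last `1`
  -- leaves a factor `ε`. The seminorms and `K` depend on `F` alone, so the choice is not circular.
  let N := K + m' + 2 + 1
  obtain ⟨E, M, hE, hs⟩ :=
    (schwartzFamily_phaseRem_mul_window a b N h).exists_seminorm_le one_le_weight s
  refine ⟨N, δ, D * E / c, M, by omega, hδ, by positivity, fun z hz => ?_⟩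
  obtain ⟨ε, hεdef⟩ : ∃ ε, ε = z.1.2.2 := ⟨_, rfl⟩
  have hε : 0 < ε := hεdef ▸ z.2.2.1
  have hε1 : ε ≤ 1 := hεdef ▸ z.2.2.2
  rw [← hεdef] at hz ⊢
  have h1 := hLc ε ⟨hε, hz⟩
  have hLpos : 0 < L ε := lt_of_lt_of_le (by positivity) h1
  refine ⟨hLpos, ?_⟩
  have hw := one_le_weight z
  have hrpow : ε ^ m' ≤ ε ^ m := by
    rw [← Real.rpow_natCast]
    exact Real.rpow_le_rpow_of_exponent_ge hε hε1 hm'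
  have hden : c * ε ^ (m' + 2) ≤ ε ^ m * L ε := by
    calc c * ε ^ (m' + 2) = ε ^ m' * (c * ε ^ 2) := by ring
      _ ≤ ε ^ m * L ε := by gcongr
  have hnum : ‖scaledTempered F ε (remAtom a b N h z)‖ ≤ D * ε⁻¹ ^ K * (E * weight z ^ M) :=
    (hF ε hε hε1 _).trans (mul_le_mul_of_nonneg_left (hs z) (by positivity))
  have hεN : (ε ^ 2) ^ N ≤ ε ^ K * (ε ^ (m' + 2) * ε) := by
    calc (ε ^ 2) ^ N = ε ^ (2 * N) := by rw [pow_mul]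
      _ ≤ ε ^ N := pow_le_pow_of_le_one hε.le hε1 (by omega)
      _ = _ := by simp only [N]; ring
  rw [norm_div, norm_mul, norm_pow, norm_pow, Complex.norm_real, Complex.norm_real,
    Real.norm_eq_abs, Real.norm_eq_abs, abs_of_pos hε,
    abs_of_pos (mul_pos (Real.rpow_pos_of_pos hε m) hLpos)]
  have hεK : ε ^ K * ε⁻¹ ^ K = 1 := by rw [← mul_pow, mul_inv_cancel₀ hε.ne', one_pow]
  calc (ε ^ 2) ^ N * ‖scaledTempered F ε (remAtom a b N h z)‖ / (ε ^ m * L ε)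
      ≤ (ε ^ K * (ε ^ (m' + 2) * ε)) * (D * ε⁻¹ ^ K * (E * weight z ^ M)) /
          (c * ε ^ (m' + 2)) := by gcongr
    _ = (ε ^ K * ε⁻¹ ^ K) * (D * E / c * ε * weight z ^ M) := by
        field_simp
    _ = _ := by rw [hεK, one_mul]

/-- `φ ↦ ⟨f(ε x), φ(x)⟩ / (ε^m L(ε))` as an element of `𝓢₀'(ℝ)`. -/
def normalizedCLM (f : LizorkinDistribution) (m : ℝ) (L : ℝ → ℝ) (ε : ℝ) :
    LizorkinDistribution :=
  ((ε ^ m * L ε : ℝ) : ℂ)⁻¹ • scaledPairingCLM f ε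

theorem normalizedCLM_apply (f : LizorkinDistribution) (m : ℝ) (L : ℝ → ℝ) (ε : ℝ) (φ : S0) :
    normalizedCLM f m L ε φ = scaledPairing f ε φ / ((ε ^ m * L ε : ℝ) : ℂ) := by
  rw [normalizedCLM, smul_apply, scaledPairingCLM_apply, smul_eq_mul, div_eq_inv_mul]

/-- A convergent sequence of functionals is pointwise bounded, so Banach–Steinhaus bounds it by one
seminorm, which grows polynomially in the weight along the atoms. -/
theorem exists_norm_taylor_sum_le {T : ℕ → LizorkinDistribution} {u : LizorkinDistribution}
    (hT : ∀ φ, Tendsto (fun n => T n φ) atTop (𝓝 (u φ))) (a b : ℝ) {h : 𝓢(ℝ, ℂ)} (hh : h ∈ S0)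
    (N : ℕ) : ∃ (C : ℝ) (M : ℕ), 0 ≤ C ∧ ∀ n (z : Param),
      ‖∑ j ∈ Finset.range N, ((Complex.I * (z.1.2.2 : ℂ) ^ 2) ^ j / (j.factorial : ℂ)) *
        T n ⟨powAtom a b j h z, powAtom_mem_S0 a b j hh z⟩‖ ≤ C * weight z ^ M := by
  obtain ⟨s, D, hD, hbd⟩ := exists_bound_of_pointwise_bounded T fun φ => by
    obtain ⟨C, hC⟩ := ((hT φ).norm.bddAbove_range)
    exact ⟨C, fun i => hC ⟨i, rfl⟩⟩
  -- The index `n` is made part of the parameter, so that the constants are uniform in it.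
  have key := exists_norm_sum_le (X := ℕ × Param) (v := fun x => weight x.2)
    (φ := fun j x => ((Complex.I * (x.2.1.2.2 : ℂ) ^ 2) ^ j / (j.factorial : ℂ)) *
        T x.1 ⟨powAtom a b j h x.2, powAtom_mem_S0 a b j hh x.2⟩)
    (fun x => one_le_weight x.2) (fun j => ?_) N
  · obtain ⟨C, M, hC, hb⟩ := key
    exact ⟨C, M, hC, fun n z => hb (n, z)⟩
  · obtain ⟨E, M, hE, hs⟩ :=
      (schwartzFamily_phase_pow_mul_window a b j h).exists_seminorm_le one_le_weight s
    refine ⟨D * E, M, by positivity, fun x => ?_⟩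
    obtain ⟨n, z⟩ := x
    have h1 : ‖(Complex.I * (z.1.2.2 : ℂ) ^ 2) ^ j / (j.factorial : ℂ)‖ ≤ 1 := by
      rw [norm_div, norm_pow, norm_mul, norm_pow, Complex.norm_I, one_mul, Complex.norm_real,
        Real.norm_eq_abs, abs_of_pos z.2.2.1, Complex.norm_natCast]
      have h2 : (1 : ℝ) ≤ j.factorial := by exact_mod_cast j.factorial_pos
      rw [div_le_one (by linarith)]
      exact (pow_le_one₀ (by positivity) (pow_le_one₀ z.2.2.1.le z.2.2.2)).trans h2
    rw [norm_mul]
    calc _ ≤ 1 * (D * (E * weight z ^ M)) := by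
          gcongr
          exact (hbd n _).trans (mul_le_mul_of_nonneg_left (hs z) hD)
      _ = _ := by ring

theorem scaledTempered_remAtom_div {F : 𝓢'(ℝ, ℂ)} {f : LizorkinDistribution}
    (hF : Represents F f) (m : ℝ) (L : ℝ → ℝ) (a b : ℝ) (N : ℕ) {h : 𝓢(ℝ, ℂ)} (hh : h ∈ S0)
    (z : Param) :
    scaledTempered F z.1.2.2 (remAtom a b 0 h z) / ((z.1.2.2 ^ m * L z.1.2.2 : ℝ) : ℂ) =
      ∑ j ∈ Finset.range N, ((Complex.I * (z.1.2.2 : ℂ) ^ 2) ^ j / (j.factorial : ℂ)) *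
        normalizedCLM f m L z.1.2.2 ⟨powAtom a b j h z, powAtom_mem_S0 a b j hh z⟩ +
      ((z.1.2.2 : ℂ) ^ 2) ^ N * scaledTempered F z.1.2.2 (remAtom a b N h z) /
        ((z.1.2.2 ^ m * L z.1.2.2 : ℝ) : ℂ) := by
  rw [remAtom_zero_eq a b N h z, scaledTempered_add, scaledTempered_sum, add_div, Finset.sum_div]
  congr 1
  · refine Finset.sum_congr rfl fun j _ => ?_
    rw [scaledTempered_smul, normalizedCLM_apply, mul_div_assoc]
    congr 2
    exact scaledTempered_eq_scaledPairing hF _ ⟨_, powAtom_mem_S0 a b j hh z⟩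
  · rw [scaledTempered_smul]

/-- The Taylor atoms do not involve `ε`, so at a fixed point of `𝕐` the quasiasymptotic hypothesis
is tested on fixed elements of `𝓢₀`. -/
theorem powAtom_toParam (a b : ℝ) (j : ℕ) (h : 𝓢(ℝ, ℂ)) (ε : ℝ) (hε : 0 < ε) (hε1 : ε ≤ 1)
    (p : ℝ × ℝ) (hp : p ∈ Y) :
    powAtom a b j h (toParam ε hε hε1 p hp) =
      powAtom a b j h (toParam 1 one_pos le_rfl p hp) := by
  ext t
  simp [toParam]

theorem c₂_pos {α : ℝ} {k : ℤ}
    (hα : α ∈ Set.Ioo (2 * (k : ℝ) * Real.pi) ((2 * (k : ℝ) + 1) * Real.pi)) : 0 < c₂ α := by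
  have h : 0 < Real.sin (α - k * (2 * Real.pi)) :=
    Real.sin_pos_of_pos_of_lt_pi (by linarith [hα.1]) (by linarith [hα.2])
  rw [Real.sin_sub_int_mul_two_pi] at h
  exact one_div_pos.2 h

end Stockwell

end

theorem mainTheorem2
    (α : ℝ) (k : ℤ) (hα : α ∈ Set.Ioo (2 * (k : ℝ) * Real.pi) ((2 * (k : ℝ) + 1) * Real.pi))
    (m : ℝ) (L : ℝ → ℝ) (hL : Stockwell.SlowlyVaryingAtZero L)
    (f u : Stockwell.LizorkinDistribution)
    (hfu : Stockwell.QuasiasymptoticAtZero f m L u)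
    (g : 𝓢(ℝ, ℂ)) (hg : g ∈ Stockwell.S0) (hg0 : g ≠ 0)
    (F U : 𝓢'(ℝ, ℂ)) (hF : Stockwell.Represents F f) (hU : Stockwell.Represents U u) :
    Stockwell.AsymptoticY
      (fun ε p =>
        Complex.exp (-Complex.I * Stockwell.c₁ α * ((ε * p.2 : ℝ) : ℂ) ^ 2 / 2) *
          Stockwell.frst α (Stockwell.dilate (1 / ε ^ 2) g) F (ε * p.1) (ε * p.2))
      (fun ε => ε ^ (m + 2) * L ε)
      (fun p =>
        (1 - Complex.I * Stockwell.c₁ α) ^ (1 / 2 : ℂ) / ((Stockwell.c₂ α ^ m : ℝ) : ℂ) *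
          Stockwell.stockwell g (Stockwell.modulateDist (p.2 / Stockwell.c₂ α) U)
            (p.1 * Stockwell.c₂ α) (p.2 / Stockwell.c₂ α)) := by
  open Stockwell in
  have hc := c₂_pos hα
  set a := c₁ α / 2 with ha
  set b := c₂ α with hb
  set h := conjSchwartz g with hh
  have hhS : h ∈ S0 := conjSchwartz_mem_S0 hg
  set G : ℝ → ℝ × ℝ → ℂ := fun ε p =>
        Complex.exp (-Complex.I * Stockwell.c₁ α * ((ε * p.2 : ℝ) : ℂ) ^ 2 / 2) *
          Stockwell.frst α (Stockwell.dilate (1 / ε ^ 2) g) F (ε * p.1) (ε * p.2) with hGdef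
  set G₀ : ℝ × ℝ → ℂ := fun p =>
        (1 - Complex.I * Stockwell.c₁ α) ^ (1 / 2 : ℂ) / ((b ^ m : ℝ) : ℂ) *
          Stockwell.stockwell g (Stockwell.modulateDist (p.2 / b) U)
            (p.1 * b) (p.2 / b) with hG₀def
  have hG : ∀ ε (hε : 0 < ε) (hε1 : ε ≤ 1) p (hp : p ∈ Y), G ε p =
      (Cα α * (ε : ℂ) ^ 2) * ((|p.2| : ℝ) : ℂ) *
        scaledTempered F ε (remAtom a b 0 h (toParam ε hε hε1 p hp)) := by
    intro ε hε hε1 p hp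
    refine (frst_eq_scaledTempered α g F (toParam ε hε hε1 p hp)).trans ?_
    simp only [toParam]
    push_cast
    ring
  have hG₀ : ∀ p (hp : p ∈ Y), G₀ p = Cα α * ((|p.2| : ℝ) : ℂ) *
      u ⟨powAtom a b 0 h (toParam 1 one_pos le_rfl p hp), powAtom_mem_S0 a b 0 hhS _⟩ := by
    intro p hp
    have h1 := stockwell_modulateDist_eq hfu hL hU hg hc a b (toParam 1 one_pos le_rfl p hp)
    simp only [hG₀def]
    refine (congrArg _ h1).trans ?_
    have h2 : ((b ^ m : ℝ) : ℂ) ≠ 0 := by exact_mod_cast (Real.rpow_pos_of_pos hc m).ne'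
    rw [Cα_eq]
    simp only [toParam]
    field_simp
    rfl
  have hdist : ∀ ε, 0 < ε → ε ≤ 1 → ContinuousOn (G ε) Y ∧ IsDistributionY (G ε) := by
    intro ε hε hε1
    obtain ⟨s, D, K, hD, hFb⟩ := exists_norm_scaledTempered_le F
    obtain ⟨E, M, hE, hs⟩ :=
      (schwartzFamily_phaseRem_mul_window a b 0 h).exists_seminorm_le one_le_weight s
    refine isDistributionY_of_eq hε hε1 (Cα α * (ε : ℂ) ^ 2)
      (V := fun z => scaledTempered F ε (remAtom a b 0 h z))
      ((continuous_scaledTempered F ε).comp (continuous_remAtom a b 0 h))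
      (C := D * ε⁻¹ ^ K * E) (M := M) (by positivity) (fun z _ => ?_) (hG ε hε hε1)
    calc _ ≤ D * ε⁻¹ ^ K * (E * weight z ^ M) :=
          (hFb ε hε hε1 _).trans (mul_le_mul_of_nonneg_left (hs z) (by positivity))
      _ = _ := by ring
  refine ⟨?_, ?_, fun Φ hΦ => ?_⟩
  · filter_upwards [Ioc_mem_nhdsGT one_pos] with ε hε using (hdist ε hε.1 hε.2).2
  -- The limit is estimated through the representative `U`, which agrees with `u` on the atoms.
  · obtain ⟨s, D, hD, hUb⟩ := exists_bound_temperedDistribution U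
    obtain ⟨E, M, hE, hs⟩ :=
      (schwartzFamily_phase_pow_mul_window a b 0 h).exists_seminorm_le one_le_weight s
    refine (isDistributionY_of_eq one_pos le_rfl (Cα α) (V := fun z => U (powAtom a b 0 h z))
      ((map_continuous U).comp (continuous_powAtom a b 0 h)) (C := D * E) (M := M)
      (by positivity) (fun z _ => ?_) fun p hp => ?_).2
    · calc _ ≤ D * (E * weight z ^ M) :=
            (hUb _).trans (mul_le_mul_of_nonneg_left (hs z) hD)
        _ = _ := by ring
    · rw [hG₀ p hp, ← hU]
  obtain ⟨N, δ, C₁, M₁, hN, hδ, hC₁, hrem⟩ := exists_remainder_bound F h a b m hL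
  -- Sequences are needed for Banach–Steinhaus: along the filter `𝓝[>] 0`, convergence gives
  -- boundedness only on a range of `ε` that may depend on the test function.
  rw [tendsto_iff_seq_tendsto]
  intro e he
  have he0 : Tendsto e atTop (𝓝 0) := (tendsto_nhdsWithin_iff.1 he).1
  have hsmall : ∀ᶠ n in atTop, e n ∈ Set.Ioc 0 (min 1 δ) :=
    he.eventually (Ioc_mem_nhdsGT (lt_min one_pos hδ))
  have hT : ∀ φ, Tendsto (fun n => normalizedCLM f m L (e n) φ) atTop (𝓝 (u φ)) := fun φ =>
    ((hfu φ).comp he).congr fun n => (normalizedCLM_apply f m L (e n) φ).symm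
  obtain ⟨C₂, M₂, hC₂, hsum⟩ := exists_norm_taylor_sum_le hT a b hhS N
  have hnorm : ∀ ε (hε : 0 < ε) (hε1 : ε ≤ 1) p (hp : p ∈ Y),
      G ε p / ((ε ^ (m + 2) * L ε : ℝ) : ℂ) = Cα α * ((|p.2| : ℝ) : ℂ) *
        (scaledTempered F ε (remAtom a b 0 h (toParam ε hε hε1 p hp)) /
          ((ε ^ m * L ε : ℝ) : ℂ)) := by
    intro ε hε hε1 p hp
    rw [hG ε hε hε1 p hp, Real.rpow_add hε, Real.rpow_two]
    have hε0 : (ε : ℂ) ≠ 0 := by exact_mod_cast hε.ne'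
    push_cast
    -- If `L ε` vanishes, both sides are `0` by the convention on division by zero.
    by_cases hLε : (L ε : ℂ) = 0
    · simp [hLε]
    have h2 : ((ε ^ m : ℝ) : ℂ) ≠ 0 := by exact_mod_cast (Real.rpow_pos_of_pos hε m).ne'
    field_simp
  have hpair : ∀ n, pairingY (G (e n)) Φ / ((e n ^ (m + 2) * L (e n) : ℝ) : ℂ) =
      pairingY (fun p => G (e n) p / ((e n ^ (m + 2) * L (e n) : ℝ) : ℂ)) Φ := fun n => by
    rw [pairingY, pairingY, ← integral_div]
    congr 1
    ext p
    ring
  refine Tendsto.congr (fun n => (hpair n).symm) ?_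
  refine tendsto_pairingY hΦ ?_ (‖Cα α‖ * (C₂ + C₁)) (M₁ + M₂ + 1) (by positivity) ?_ ?_
  · filter_upwards [hsmall] with n hn
    exact (hdist (e n) hn.1 (hn.2.trans (min_le_left _ _))).1.div_const _
  · filter_upwards [hsmall] with n hn p hp
    have hε1 : e n ≤ 1 := hn.2.trans (min_le_left _ _)
    rw [hnorm (e n) hn.1 hε1 p hp]
    have h1 := hsum n (toParam (e n) hn.1 hε1 p hp)
    have h2 := (hrem (toParam (e n) hn.1 hε1 p hp) (hn.2.trans (min_le_right _ _))).2
    have h3 := scaledTempered_remAtom_div hF m L a b N hhS (toParam (e n) hn.1 hε1 p hp)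
    have h4 := abs_snd_le_weight (toParam (e n) hn.1 hε1 p hp)
    have h0 := one_le_weightY p
    change _ ≤ C₂ * weightY p ^ M₂ at h1
    change _ ≤ C₁ * e n * weightY p ^ M₁ at h2
    change |p.2| ≤ weightY p at h4
    change scaledTempered F (e n) _ / ((e n ^ m * L (e n) : ℝ) : ℂ) = _ at h3
    rw [h3, norm_mul, norm_mul, Complex.norm_real, Real.norm_eq_abs, abs_abs]
    have h5 : C₁ * e n * weightY p ^ M₁ ≤ C₁ * weightY p ^ M₁ := by
      have : C₁ * e n ≤ C₁ := mul_le_of_le_one_right hC₁ hε1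
      gcongr
    calc _ ≤ ‖Cα α‖ * weightY p * (C₂ * weightY p ^ M₂ + C₁ * weightY p ^ M₁) := by
          gcongr
          exact (norm_add_le _ _).trans (add_le_add h1 (h2.trans h5))
      _ ≤ ‖Cα α‖ * weightY p *
          (C₂ * weightY p ^ (M₁ + M₂) + C₁ * weightY p ^ (M₁ + M₂)) := by
          gcongr <;> first | assumption | omega
      _ = _ := by ring
  · intro p hp
    rw [hG₀ p hp]
    set A := fun j => (⟨powAtom a b j h (toParam 1 one_pos le_rfl p hp),
      powAtom_mem_S0 a b j hhS _⟩ : S0) with hA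
    -- The terms with `j > 0` tend to `0` through `ε^{2j}`, since their pairings converge; `0 < N`
    -- guarantees that `j = 0` occurs in the sum.
    have hlim1 : Tendsto (fun n => ∑ j ∈ Finset.range N,
        ((Complex.I * (e n : ℂ) ^ 2) ^ j / (j.factorial : ℂ)) *
          normalizedCLM f m L (e n) (A j)) atTop (𝓝 (u (A 0))) := by
      have hj : ∀ j ∈ Finset.range N, Tendsto (fun n =>
          ((Complex.I * (e n : ℂ) ^ 2) ^ j / (j.factorial : ℂ)) *
            normalizedCLM f m L (e n) (A j)) atTop
          (𝓝 (((Complex.I * ((0 : ℝ) : ℂ) ^ 2) ^ j / (j.factorial : ℂ)) * u (A j))) :=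
        fun j _ => by
          have hce : Tendsto (fun n => (e n : ℂ)) atTop (𝓝 ((0 : ℝ) : ℂ)) :=
            (Complex.continuous_ofReal.tendsto 0).comp he0
          exact ((((hce.pow 2).const_mul _).pow j).div_const _).mul (hT (A j))
      have := tendsto_finsetSum _ hj
      rwa [Finset.sum_eq_single_of_mem 0 (Finset.mem_range.2 hN) (fun j _ hj0 => by
        simp [hj0]), pow_zero, Nat.factorial_zero, Nat.cast_one, div_one, one_mul] at this
    have hbound : Tendsto (fun n => C₁ * e n * weightY p ^ M₁) atTop (𝓝 0) := by
      simpa using (he0.const_mul C₁).mul_const (weightY p ^ M₁)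
    -- The difference is exactly the Taylor remainder, of size `O(ε)` at the fixed point `p`.
    have hlim2 : Tendsto (fun n => G (e n) p / ((e n ^ (m + 2) * L (e n) : ℝ) : ℂ) -
        Cα α * ((|p.2| : ℝ) : ℂ) * ∑ j ∈ Finset.range N,
        ((Complex.I * (e n : ℂ) ^ 2) ^ j / (j.factorial : ℂ)) *
          normalizedCLM f m L (e n) (A j)) atTop (𝓝 0) := by
      have hbound' := hbound.const_mul (‖Cα α * ((|p.2| : ℝ) : ℂ)‖)
      rw [mul_zero] at hbound'
      refine squeeze_zero_norm' ?_ hbound'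
      filter_upwards [hsmall] with n hn
      have hε1 : e n ≤ 1 := hn.2.trans (min_le_left _ _)
      have h2 := (hrem (toParam (e n) hn.1 hε1 p hp) (hn.2.trans (min_le_right _ _))).2
      have h3 := scaledTempered_remAtom_div hF m L a b N hhS (toParam (e n) hn.1 hε1 p hp)
      simp only [powAtom_toParam] at h3
      change _ ≤ C₁ * e n * weightY p ^ M₁ at h2
      change scaledTempered F (e n) _ / ((e n ^ m * L (e n) : ℝ) : ℂ) =
        ∑ j ∈ Finset.range N, ((Complex.I * (e n : ℂ) ^ 2) ^ j / (j.factorial : ℂ)) *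
          normalizedCLM f m L (e n) (A j) + _ at h3
      rw [hnorm (e n) hn.1 hε1 p hp, h3, ← mul_sub, add_sub_cancel_left, norm_mul]
      gcongr
    have := hlim2.add (hlim1.const_mul (Cα α * ((|p.2| : ℝ) : ℂ)))
    simpa using this
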